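/- Let $F$ be a real quadratic field with ring of integers $\mathcal{O}_F$, let $x\mapsto x'$ be its conjugation, and regard $F$ as a subfield of $\mathbb{R}$, so that $x\mapsto x$ and $x\mapsto x'$ are the two real embeddings of $F$. Let $\mathbb{H}=\{\tau\in\mathbb{C} : \operatorname{Im}\tau>0\}$, and let $\mathrm{SL}_2(F)$ act on $\mathbb{H}^2$ by $$\begin{pmatrix}a&b\\c&d\end{pmatrix}(z_1,z_2)=\left(\frac{az_1+b}{cz_1+d},\frac{a'z_2+b'}{c'z_2+d'}\right).$$ Let $\Gamma\subset\mathrm{SL}_2(F)$ be a subgroup commensurable with $\mathrm{SL}_2(\mathcal{O}_F)$, i.e. $\Gamma\cap\mathrm{SL}_2(\mathcal{O}_F)$ has finite index in both groups, and let $(k_1,k_2)\in\mathbb{Z}^2$. Let $f:\mathbb{H}^2\to\mathbb{C}$ be a holomorphic Hilbert modular form of weight $(k_1,k_2)$ for $\Gamma$, that is, a holomorphic function with $$f(\gamma z)=(cz_1+d)^{k_1}(c'z_2+d')^{k_2}f(z)\qquad\text{for all } z\in\mathbb{H}^2,\ \gamma=\begin{pmatrix}a&b\\c&d\end{pmatrix}\in\Gamma.$$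 Then $f$ vanishes identically unless $k_1,k_2$ are both positive or $k_1=k_2=0$. If $k_1=k_2=0$, then $f$ is constant. -/

import Mathlib

open scoped UpperHalfPlane MatrixGroups NumberField

namespace HilbertModular

/-- The Hilbert modular group `SL₂(𝓞_F)`, as a subgroup of `SL₂(F)`. -/
def fullGroup (F : Type*) [Field F] [NumberField F] : Subgroup SL(2, F) :=
  (Matrix.SpecialLinearGroup.map (n := Fin 2) (algebraMap (𝓞 F) F)).range

/-- The action of `SL₂(F)` on `ℍ × ℍ` by fractional linear transformations, through the two
real embeddings `σ₁`, `σ₂` of `F` (one for each factor). -/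
noncomputable def act {F : Type*} [Field F] (σ₁ σ₂ : F →+* ℝ) (γ : SL(2, F)) (z : ℍ × ℍ) : ℍ × ℍ :=
  (Matrix.SpecialLinearGroup.map σ₁ γ • z.1, Matrix.SpecialLinearGroup.map σ₂ γ • z.2)

/-- `f : ℍ × ℍ → ℂ` is holomorphic: as a function of two complex variables it is complex
differentiable on the open subset `{Im z₁ > 0, Im z₂ > 0}` of `ℂ × ℂ`
(`UpperHalfPlane.ofComplex` is the inverse of the inclusion `ℍ → ℂ` there). -/
def IsHolomorphic (f : ℍ × ℍ → ℂ) : Prop :=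
  DifferentiableOn ℂ
    (fun w : ℂ × ℂ => f (UpperHalfPlane.ofComplex w.1, UpperHalfPlane.ofComplex w.2))
    {w : ℂ × ℂ | 0 < w.1.im ∧ 0 < w.2.im}

/-- Holomorphic Hilbert modular forms of weight `(k₁, k₂)` for `Γ ⊆ SL₂(F)`: holomorphic
functions on `ℍ × ℍ` with `f (γ z) = (c z₁ + d) ^ k₁ (c' z₂ + d') ^ k₂ f z` for all
`γ = (a, b; c, d) ∈ Γ`. -/
structure IsHolomorphicForm {F : Type*} [Field F] (σ₁ σ₂ : F →+* ℝ) (Γ : Subgroup SL(2, F))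
    (k₁ k₂ : ℤ) (f : ℍ × ℍ → ℂ) : Prop where
  holomorphic : IsHolomorphic f
  transform : ∀ γ ∈ Γ, ∀ z : ℍ × ℍ,
    f (act σ₁ σ₂ γ z) =
      ((σ₁ (γ 1 0) : ℂ) * (z.1 : ℂ) + (σ₁ (γ 1 1) : ℂ)) ^ k₁ *
        ((σ₂ (γ 1 0) : ℂ) * (z.2 : ℂ) + (σ₂ (γ 1 1) : ℂ)) ^ k₂ * f z

end HilbertModular

namespace HilbertModular

open Complex Filter Topology Set

/-! The proof is a maximum principle for the Petersson norm `|G| y₁^(k₁/2) y₂^(k₂/2)`, which is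
`Γ`-invariant. By symmetry let `k₁ ≤ k₂`; the excluded weights then satisfy `k₁ ≤ 0` and either `k₁
< k₂` or `k₁ = k₂ < 0`.

No growth condition is imposed at the cusps, so a Koecher principle comes first. At each cusp the
stabiliser in `Γ` contains a lattice of translations, which makes suprema over real parts finite,
and a hyperbolic element acting by `(δ z, δ⁻¹ w)`. Hadamard's three lines theorem makes these
suprema log-convex in the heights. Interpolating between two far-apart hyperbolic translates of a
compact set of heights (`CuspInvariant.exists_norm_le`) gives boundedness for `k₁ = k₂` and decay
for `k₁ < k₂`; periodicity and the Schwarz lemma improve decay to exponential decay. Hence the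
Petersson norm tends to zero as `y₁ y₂ → ∞` (`CuspInvariant.petersson_tendsto_zero`).

Reduction theory (`exists_reduction`), from Minkowski's theorem and finiteness of the class group,
covers `ℍ × ℍ` by finitely many cusp neighbourhoods up to `Γ`, so the norm attains a global maximum
at some `(p, q)`. On the slice `w = q`, the function `G(z, q) / (z - p̄)^(-k₁)` then has its largest
modulus at `z = p`, hence is constant. Decay as `Im z → ∞` forces the constant to be zero
(`CurveHolomorphic.eq_zero_of_isMax`), so the maximum is zero.

In weight `(0, 0)`, the derivative in the first variable has weight `(2, 0)` and vanishes by the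
preceding case; by symmetry the form is constant in both variables. -/

/-- A function of two complex variables that is continuous on `ℍ × ℍ` and holomorphic along every
holomorphic curve in `ℍ × ℍ`. -/
structure CurveHolomorphic (G : ℂ → ℂ → ℂ) : Prop where
  continuousOn : ContinuousOn (fun w : ℂ × ℂ => G w.1 w.2) {w | 0 < w.1.im ∧ 0 < w.2.im}
  differentiableOn : ∀ (V : Set ℂ) (α β : ℂ → ℂ), IsOpen V → DifferentiableOn ℂ α V →
    DifferentiableOn ℂ β V → (∀ t ∈ V, 0 < (α t).im ∧ 0 < (β t).im) →
    DifferentiableOn ℂ (fun t => G (α t) (β t)) V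

/-- The Petersson norm `|G| y₁ ^ (k₁ / 2) y₂ ^ (k₂ / 2)`. -/
noncomputable def petersson (k₁ k₂ : ℤ) (G : ℂ → ℂ → ℂ) (z w : ℂ) : ℝ :=
  ‖G z w‖ * √z.im ^ k₁ * √w.im ^ k₂

/-- The behaviour at the cusp `∞`: `G` is invariant under a lattice of translations, and its
Petersson norm under a hyperbolic element. -/
structure CuspInvariant (k₁ k₂ : ℤ) (G : ℂ → ℂ → ℂ) (N a b δ : ℝ) : Prop where
  holo : CurveHolomorphic G
  pos : 0 < N
  ne : a ≠ b
  one_lt : 1 < δ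
  periodic_diag : ∀ z w : ℂ, 0 < z.im → 0 < w.im → G (z + N) (w + N) = G z w
  periodic : ∀ z w : ℂ, 0 < z.im → 0 < w.im → G (z + a) (w + b) = G z w
  scale : ∀ z w : ℂ, 0 < z.im → 0 < w.im →
    petersson k₁ k₂ G (δ * z) ((δ⁻¹ : ℝ) * w) = petersson k₁ k₂ G z w

/-! ### Translations, and decay of periodic functions of one variable -/

lemma periodic_nat {G : ℂ → ℂ → ℂ} {a b : ℝ}
    (h : ∀ z w : ℂ, 0 < z.im → 0 < w.im → G (z + a) (w + b) = G z w) (n : ℕ) (z w : ℂ)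
    (hz : 0 < z.im) (hw : 0 < w.im) : G (z + (n * a : ℝ)) (w + (n * b : ℝ)) = G z w := by
  induction n with
  | zero => simp
  | succ n ih =>
    rw [← ih, ← h (z + (n * a : ℝ)) (w + (n * b : ℝ)) (by simpa using hz) (by simpa using hw)]
    congr 1 <;> push_cast <;> ring

lemma periodic_int {G : ℂ → ℂ → ℂ} {a b : ℝ}
    (h : ∀ z w : ℂ, 0 < z.im → 0 < w.im → G (z + a) (w + b) = G z w) (n : ℤ) (z w : ℂ)
    (hz : 0 < z.im) (hw : 0 < w.im) : G (z + (n * a : ℝ)) (w + (n * b : ℝ)) = G z w := by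
  obtain ⟨m, rfl | rfl⟩ := n.eq_nat_or_neg
  · exact_mod_cast periodic_nat h m z w hz hw
  · rw [← periodic_nat h m (z + ((-m : ℤ) * a : ℝ)) (w + ((-m : ℤ) * b : ℝ))
      (by simpa using hz) (by simpa using hw)]
    congr 1 <;> push_cast <;> ring

/-- Exponential decay of a periodic function tending to zero. -/
lemma norm_le_exp_of_periodic {N C : ℝ} (hN : 0 < N) {h : ℂ → ℂ}
    (hd : DifferentiableOn ℂ h {t | 0 < t.im}) (hp : ∀ t : ℂ, 0 < t.im → h (t + N) = h t)
    (hC : ∀ t : ℂ, 0 < t.im → ‖h t‖ ≤ C) (h0 : Tendsto h (comap im atTop) (𝓝 0))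
    {t : ℂ} (ht : 0 < t.im) : ‖h t‖ ≤ C * Real.exp (-2 * Real.pi * t.im / N) := by
  classical
  set g : ℂ → ℂ := fun t => if 0 < t.im then h t else 0 with hg
  have hgh : ∀ t : ℂ, 0 < t.im → g t = h t := fun t ht => by simp [hg, ht]
  have hper : Function.Periodic g (N : ℂ) := by
    intro t
    by_cases ht : 0 < t.im
    · simp [hg, ht, hp t ht]
    · simp [hg, ht]
  have hopen : IsOpen {t : ℂ | 0 < t.im} := isOpen_lt continuous_const continuous_im
  have hgd : ∀ t : ℂ, 0 < t.im → DifferentiableAt ℂ g t := fun t ht =>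
    ((hd t ht).differentiableAt (hopen.mem_nhds ht)).congr_of_eventuallyEq
      (by filter_upwards [hopen.mem_nhds ht] with s hs using hgh s hs)
  have hev : ∀ᶠ t : ℂ in comap im atTop, 0 < t.im :=
    preimage_mem_comap (Ioi_mem_atTop (0 : ℝ))
  have hz : ZeroAtFilter (comap im atTop) g :=
    h0.congr' (by filter_upwards [hev] with s hs using (hgh s hs).symm)
  have hC0 : 0 ≤ C := (norm_nonneg _).trans (hC t ht)
  have hgC : ∀ t : ℂ, ‖g t‖ ≤ C := by
    intro t
    by_cases ht : 0 < t.im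
    · rw [hgh t ht]; exact hC t ht
    · simpa [hg, ht] using hC0
  -- In the coordinate `q = exp(2πit/N)`, `h` extends over the disc with a zero at `0`; the Schwarz
  -- lemma gives `‖h‖ ≤ C ‖q‖`.
  have hc0 := Function.Periodic.cuspFunction_zero_of_zero_at_inf hN hz
  have hcd : DifferentiableOn ℂ (Function.Periodic.cuspFunction N g) (Metric.ball 0 1) := by
    intro q hq
    apply DifferentiableAt.differentiableWithinAt
    by_cases hq0 : q = 0
    · rw [hq0]
      exact Function.Periodic.differentiableAt_cuspFunction_zero hN hper
        (by filter_upwards [hev] with s hs using hgd s hs) hz.boundedAtFilter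
    · have hi := Function.Periodic.qParam_right_inv hN.ne' hq0
      rw [← hi]
      refine Function.Periodic.differentiableAt_cuspFunction hN.ne' hper (hgd _ ?_)
      rw [Function.Periodic.im_invQParam]
      have : Real.log ‖q‖ < 0 := Real.log_neg (norm_pos_iff.2 hq0) (by simpa using hq)
      have h2 : -N / (2 * Real.pi) < 0 := div_neg_of_neg_of_pos (by linarith) (by positivity)
      exact mul_pos_of_neg_of_neg h2 this
  have hmaps : MapsTo (Function.Periodic.cuspFunction N g) (Metric.ball 0 1)
      (Metric.closedBall (Function.Periodic.cuspFunction N g 0) C) := by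
    intro q _
    rw [hc0, mem_closedBall_zero_iff]
    by_cases hq0 : q = 0
    · rw [hq0, hc0, norm_zero]; exact hC0
    · rw [Function.Periodic.cuspFunction_eq_of_nonzero _ _ hq0]; exact hgC _
  have hqt : Function.Periodic.qParam N t ∈ Metric.ball (0 : ℂ) 1 := by
    simpa using Function.Periodic.norm_qParam_lt_one hN ht
  have := Complex.dist_le_div_mul_dist_of_mapsTo_ball hcd hmaps hqt
  rwa [hc0, dist_zero_right, dist_zero_right, Function.Periodic.eq_cuspFunction hN.ne' hper,
    hgh t ht, div_one, Function.Periodic.norm_qParam] at this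

/-! ### Behaviour at a cusp: Koecher principle and decay -/

namespace CuspInvariant

variable {k₁ k₂ : ℤ} {G : ℂ → ℂ → ℂ} {N a b δ : ℝ}

/-- Translations move every point into a bounded box. -/
lemma exists_translate (hG : CuspInvariant k₁ k₂ G N a b δ) :
    ∃ B : ℝ, ∀ z w : ℂ, 0 < z.im → 0 < w.im → ∃ z' w' : ℂ, z'.im = z.im ∧ w'.im = w.im ∧
      |z'.re| ≤ B ∧ |w'.re| ≤ B ∧ G z' w' = G z w := by
  refine ⟨N + |a| + |b|, fun z w hz hw => ?_⟩
  have hN := hG.pos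
  have hab : a - b ≠ 0 := sub_ne_zero.2 hG.ne
  -- `(s, t)` are the coordinates of `(Re z, Re w)` in the basis `(N, N)`, `(a, b)` of `ℝ²`; their
  -- integer parts are translated away.
  set t : ℝ := (z.re - w.re) / (a - b) with ht
  set s : ℝ := (z.re - t * a) / N with hs
  have e1 : z.re = s * N + t * a := by rw [hs]; field_simp; ring
  have e2 : w.re = s * N + t * b := by
    have : t * (a - b) = z.re - w.re := by rw [ht]; field_simp
    linarith
  have key : ∀ c : ℝ, |c| ≤ |a| + |b| → |Int.fract s * N + Int.fract t * c| ≤ N + |a| + |b| := by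
    intro c hc
    have h1 := Int.fract_nonneg s
    have h2 := (Int.fract_lt_one s).le
    have h3 := Int.fract_nonneg t
    have h4 := (Int.fract_lt_one t).le
    calc _ ≤ |Int.fract s * N| + |Int.fract t * c| := abs_add_le _ _
      _ = Int.fract s * N + Int.fract t * |c| := by
        rw [abs_mul, abs_mul, abs_of_nonneg h1, abs_of_nonneg h3, abs_of_pos hN]
      _ ≤ 1 * N + 1 * |c| := by gcongr
      _ ≤ _ := by linarith
  refine ⟨z + ((-⌊s⌋ : ℤ) * N : ℝ) + ((-⌊t⌋ : ℤ) * a : ℝ),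
    w + ((-⌊s⌋ : ℤ) * N : ℝ) + ((-⌊t⌋ : ℤ) * b : ℝ), by simp, by simp, ?_, ?_, ?_⟩
  · convert key a (by linarith [abs_nonneg b]) using 2
    simp only [add_re, ofReal_re, e1, Int.fract]; push_cast; ring
  · convert key b (by linarith [abs_nonneg a]) using 2
    simp only [add_re, ofReal_re, e2, Int.fract]; push_cast; ring
  · rw [periodic_int hG.periodic _ _ _ (by simpa using hz) (by simpa using hw),
      periodic_int hG.periodic_diag _ _ _ hz hw]

lemma isCompact_box {l u B : ℝ} : IsCompact
    {p : ℂ × ℂ | |p.1.re| ≤ B ∧ |p.2.re| ≤ B ∧ p.1.im ∈ Icc l u ∧ p.2.im ∈ Icc l u} := by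
  have h1 : IsCompact (Icc (-B) B ×ℂ Icc l u) := isCompact_Icc.reProdIm isCompact_Icc
  convert h1.prod h1 using 1
  ext p
  simp only [mem_ofPred_eq, mem_prod, mem_reProdIm, mem_Icc, abs_le]
  tauto

lemma bounded_of_im_mem (hG : CuspInvariant k₁ k₂ G N a b δ) {l u : ℝ} (hl : 0 < l) :
    ∃ C : ℝ, 0 ≤ C ∧ ∀ z w : ℂ, z.im ∈ Icc l u → w.im ∈ Icc l u → ‖G z w‖ ≤ C := by
  obtain ⟨B, hB⟩ := hG.exists_translate
  obtain ⟨C, hC⟩ := (isCompact_box (l := l) (u := u) (B := B)).exists_bound_of_continuousOn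
    (hG.holo.continuousOn.mono fun p hp => ⟨hl.trans_le hp.2.2.1.1, hl.trans_le hp.2.2.2.1⟩)
  refine ⟨max C 0, le_max_right _ _, fun z w hz hw => ?_⟩
  obtain ⟨z', w', e1, e2, h1, h2, h⟩ := hB z w (hl.trans_le hz.1) (hl.trans_le hw.1)
  rw [← h]
  exact (hC (z', w') ⟨h1, h2, e1 ▸ hz, e2 ▸ hw⟩).trans (le_max_left _ _)

/-- Log-convexity of `y ↦ sup_x |G (x + i y)|`. -/
lemma norm_le_interp (hG : CuspInvariant k₁ k₂ G N a b δ) {p q p' q' A B s : ℝ}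
    (hp : 0 < p) (hq : 0 < q) (hp' : 0 < p') (hq' : 0 < q') (hs : s ∈ Icc (0 : ℝ) 1)
    (hA : ∀ z w : ℂ, z.im = p → w.im = q → ‖G z w‖ ≤ A)
    (hB : ∀ z w : ℂ, z.im = p' → w.im = q' → ‖G z w‖ ≤ B) {z w : ℂ}
    (hz : z.im = p + s * (p' - p)) (hw : w.im = q + s * (q' - q)) :
    ‖G z w‖ ≤ A ^ (1 - s) * B ^ s := by
  -- The heights of `α t` and `β t` depend only on `Re t`, so vertical lines in the strip lie over
  -- fixed heights, where `A` and `B` apply.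
  set α : ℂ → ℂ := fun t => z.re + I * (p + t * (p' - p)) with hα
  set β : ℂ → ℂ := fun t => w.re + I * (q + t * (q' - q)) with hβ
  have hαi : ∀ t, (α t).im = p + t.re * (p' - p) := fun t => by simp [hα]
  have hβi : ∀ t, (β t).im = q + t.re * (q' - q) := fun t => by simp [hβ]
  have hαc : Differentiable ℂ α := by fun_prop
  have hβc : Differentiable ℂ β := by fun_prop
  set V : Set ℂ := {t | 0 < (α t).im ∧ 0 < (β t).im} with hV
  have hVo : IsOpen V := (isOpen_lt continuous_const (continuous_im.comp hαc.continuous)).inter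
    (isOpen_lt continuous_const (continuous_im.comp hβc.continuous))
  have hconv : ∀ x y r : ℝ, r ∈ Icc (0 : ℝ) 1 → x + r * (y - x) ∈ Icc (min x y) (max x y) := by
    rintro x y r ⟨h0, h1⟩
    have e : x + r * (y - x) = (1 - r) * x + r * y := by ring
    have h2 : 0 ≤ 1 - r := by linarith
    constructor
    · calc min x y = (1 - r) * min x y + r * min x y := by ring
        _ ≤ (1 - r) * x + r * y := by gcongr <;> simp
        _ = _ := e.symm
    · calc _ = (1 - r) * x + r * y := e
        _ ≤ (1 - r) * max x y + r * max x y := by gcongr <;> simp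
        _ = max x y := by ring
  have hsub : HadamardThreeLines.verticalClosedStrip 0 1 ⊆ V := by
    intro t ht
    rw [hV, mem_ofPred_eq, hαi, hβi]
    exact ⟨(lt_min hp hp').trans_le (hconv _ _ _ ht).1, (lt_min hq hq').trans_le (hconv _ _ _ ht).1⟩
  have hd := hG.holo.differentiableOn V α β hVo hαc.differentiableOn hβc.differentiableOn
    (fun t ht => ht)
  have hcl : closure (HadamardThreeLines.verticalStrip 0 1) ⊆
      HadamardThreeLines.verticalClosedStrip 0 1 :=
    closure_minimal (preimage_mono Ioo_subset_Icc_self) (isClosed_Icc.preimage continuous_re)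
  obtain ⟨C, -, hC⟩ := hG.bounded_of_im_mem (l := min (min p p') (min q q'))
    (u := max (max p p') (max q q')) (by simp [hp, hp', hq, hq'])
  have main := HadamardThreeLines.norm_le_interp_of_mem_verticalClosedStrip₀₁'
    (fun t => G (α t) (β t)) (z := (s : ℂ)) (a := A) (b := B)
    (show (s : ℂ).re ∈ Icc (0 : ℝ) 1 by simpa using hs)
    ((hd.mono (hcl.trans hsub)).diffContOnCl) ?_ ?_ ?_
  · have e1 : α s = z := by apply Complex.ext <;> simp [hα, hz]
    have e2 : β s = w := by apply Complex.ext <;> simp [hβ, hw]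
    simpa [e1, e2] using main
  · refine ⟨C, ?_⟩
    rintro _ ⟨t, ht, rfl⟩
    have h1 := hconv p p' _ ht
    have h2 := hconv q q' _ ht
    apply hC
    · rw [hαi]
      exact ⟨(min_le_left _ _).trans h1.1, h1.2.trans (le_max_left _ _)⟩
    · rw [hβi]
      exact ⟨(min_le_right _ _).trans h2.1, h2.2.trans (le_max_right _ _)⟩
  · intro t ht
    have ht : t.re = 0 := ht
    exact hA _ _ (by rw [hαi, ht]; ring) (by rw [hβi, ht]; ring)
  · intro t ht
    have ht : t.re = 1 := ht
    exact hB _ _ (by rw [hαi, ht]; ring) (by rw [hβi, ht]; ring)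

lemma scale_zpow (hG : CuspInvariant k₁ k₂ G N a b δ) (n : ℤ) (z w : ℂ) (hz : 0 < z.im)
    (hw : 0 < w.im) :
    petersson k₁ k₂ G ((δ ^ n : ℝ) * z) ((δ ^ (-n) : ℝ) * w) = petersson k₁ k₂ G z w := by
  have hδ : 0 < δ := one_pos.trans hG.one_lt
  have step : ∀ m : ℤ, petersson k₁ k₂ G ((δ ^ (m + 1) : ℝ) * z) ((δ ^ (-(m + 1)) : ℝ) * w) =
      petersson k₁ k₂ G ((δ ^ m : ℝ) * z) ((δ ^ (-m) : ℝ) * w) := by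
    intro m
    rw [← hG.scale ((δ ^ m : ℝ) * z) ((δ ^ (-m) : ℝ) * w)
      (by rw [im_ofReal_mul]; positivity) (by rw [im_ofReal_mul]; positivity)]
    congr 1
    · rw [← mul_assoc, ← ofReal_mul, zpow_add_one₀ hδ.ne', mul_comm δ]
    · rw [← mul_assoc, ← ofReal_mul, neg_add, zpow_add₀ hδ.ne', zpow_neg_one, mul_comm δ⁻¹]
  induction n using Int.induction_on with
  | zero => simp
  | succ m ih => rw [step, ih]
  | pred m ih => rw [← ih, ← step (-(m : ℤ) - 1)]; simp

/-- The two heights scale by inverse factors, so invariance of the Petersson norm leaves a power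
governed by the difference of the weights. -/
lemma norm_scale_zpow (hG : CuspInvariant k₁ k₂ G N a b δ) (n : ℤ) (z w : ℂ) (hz : 0 < z.im)
    (hw : 0 < w.im) :
    ‖G ((δ ^ n : ℝ) * z) ((δ ^ (-n) : ℝ) * w)‖ = √δ ^ (n * (k₂ - k₁)) * ‖G z w‖ := by
  have hδ : 0 < δ := one_pos.trans hG.one_lt
  have h := hG.scale_zpow n z w hz hw
  have hr : 0 < √δ := Real.sqrt_pos.2 hδ
  have hs : ∀ m : ℤ, √(δ ^ m) = √δ ^ m := by
    intro m
    rw [Real.sqrt_eq_iff_mul_self_eq (by positivity) (by positivity), ← mul_zpow,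
      Real.mul_self_sqrt hδ.le]
  unfold petersson at h
  rw [im_ofReal_mul, im_ofReal_mul, Real.sqrt_mul (by positivity), Real.sqrt_mul (by positivity),
    hs, hs, mul_zpow, mul_zpow, ← zpow_mul, ← zpow_mul] at h
  have h1 : 0 < √z.im ^ k₁ := zpow_pos (Real.sqrt_pos.2 hz) _
  have h2 : 0 < √w.im ^ k₂ := zpow_pos (Real.sqrt_pos.2 hw) _
  have e : √δ ^ (n * (k₂ - k₁)) * (√δ ^ (n * k₁) * √δ ^ (-n * k₂)) = 1 := by
    rw [← zpow_add₀ hr.ne', ← zpow_add₀ hr.ne']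
    convert zpow_zero √δ using 2
    ring
  have h3 : ‖G ((δ ^ n : ℝ) * z) ((δ ^ (-n) : ℝ) * w)‖ * (√δ ^ (n * k₁) * √δ ^ (-n * k₂)) =
      ‖G z w‖ := by
    apply mul_right_cancel₀ (mul_pos h1 h2).ne'
    linear_combination h
  rw [← h3, ← mul_assoc, mul_comm _ ‖_‖, mul_assoc, e, mul_one]

/-- The Koecher principle: polynomial decay in a Siegel domain. -/
lemma exists_norm_le (hG : CuspInvariant k₁ k₂ G N a b δ) {R : ℝ} (hR : 1 ≤ R) :
    ∃ C : ℝ, 0 ≤ C ∧ ∀ z w : ℂ, 1 ≤ z.im → w.im ≤ R * z.im → z.im ≤ R * w.im →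
      ∃ n : ℕ, z.im ≤ δ ^ (n + 1) ∧
        ‖G z w‖ ≤ C * (√δ ^ (n * (k₂ - k₁))) ^ (-(1 / 3 : ℝ)) := by
  have hδ1 := hG.one_lt
  have hδ : 0 < δ := one_pos.trans hδ1
  have hR0 : 0 < R := one_pos.trans_le hR
  obtain ⟨C, hC0, hC⟩ := hG.bounded_of_im_mem (l := R⁻¹) (u := 3 * R * δ) (by positivity)
  refine ⟨C, hC0, fun z w hz hw1 hw2 => ?_⟩
  have hw : 0 < w.im := by
    by_contra h
    nlinarith
  obtain ⟨n, hn1, hn2⟩ := exists_nat_pow_near hz hδ1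
  refine ⟨n, hn2.le, ?_⟩
  set D : ℝ := δ ^ n with hD
  have hD1 : 1 ≤ D := one_le_pow₀ hδ1.le
  have hD0 : 0 < D := one_pos.trans_le hD1
  have hDi : D⁻¹ ≤ D := (inv_le_one_of_one_le₀ hD1).trans hD1
  have hDi0 : 0 < D⁻¹ := inv_pos.2 hD0
  -- With these factors `(Im z, Im w)` is the point at parameter `1/3` on the segment from `(p/D,
  -- qD)` to `(pD, q/D)`. Both factors are comparable to `D`, so `p` and `q` stay in a fixed compact
  -- interval.
  set c₁ : ℝ := D / 3 + 2 / 3 * D⁻¹ with hc₁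
  set c₂ : ℝ := D⁻¹ / 3 + 2 / 3 * D with hc₂
  have hc₁0 : 0 < c₁ := by positivity
  have hc₂0 : 0 < c₂ := by positivity
  set p : ℝ := z.im / c₁ with hp
  set q : ℝ := w.im / c₂ with hq
  have hp0 : 0 < p := div_pos (by linarith) hc₁0
  have hq0 : 0 < q := div_pos hw hc₂0
  have hn2' : z.im < D * δ := by rwa [pow_succ] at hn2
  have hpm : p ∈ Icc R⁻¹ (3 * R * δ) := by
    constructor
    · calc R⁻¹ ≤ 1 := inv_le_one_of_one_le₀ hR
        _ ≤ p := by rw [hp, le_div_iff₀ hc₁0]; linarith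
    · rw [hp, div_le_iff₀ hc₁0]
      calc z.im ≤ D * δ := hn2'.le
        _ = 3 * 1 * δ * (D / 3) := by ring
        _ ≤ 3 * R * δ * c₁ := by gcongr; linarith
  have hqm : q ∈ Icc R⁻¹ (3 * R * δ) := by
    constructor
    · rw [hq, le_div_iff₀ hc₂0, inv_mul_le_iff₀ hR0]; linarith
    · rw [hq, div_le_iff₀ hc₂0]
      calc w.im ≤ R * z.im := hw1
        _ ≤ R * (D * δ) := by gcongr
        _ = 3 * R * δ * (D / 3) := by ring
        _ ≤ 3 * R * δ * c₂ := by gcongr; linarith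
  set X : ℝ := √δ ^ (n * (k₂ - k₁)) with hX
  have hX0 : 0 < X := zpow_pos (Real.sqrt_pos.2 hδ) _
  have hA : ∀ z' w' : ℂ, z'.im = D⁻¹ * p → w'.im = D * q → ‖G z' w'‖ ≤ X⁻¹ * C := by
    intro z' w' h1 h2
    have hz' : ((D : ℂ) * z').im = p := by rw [im_ofReal_mul, h1]; field_simp
    have hw' : (((D⁻¹ : ℝ) : ℂ) * w').im = q := by rw [im_ofReal_mul, h2]; field_simp
    have h := hG.norm_scale_zpow (-n) (D * z') ((D⁻¹ : ℝ) * w') (by rw [hz']; exact hp0)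
      (by rw [hw']; exact hq0)
    rw [neg_neg, zpow_neg, zpow_natCast, ← hD, ← mul_assoc, ← mul_assoc, ← ofReal_mul,
      ← ofReal_mul, inv_mul_cancel₀ hD0.ne', mul_inv_cancel₀ hD0.ne', ofReal_one, one_mul,
      one_mul, neg_mul, zpow_neg, ← hX] at h
    rw [h]
    gcongr
    exact hC _ _ (hz' ▸ hpm) (hw' ▸ hqm)
  have hB : ∀ z' w' : ℂ, z'.im = D * p → w'.im = D⁻¹ * q → ‖G z' w'‖ ≤ X * C := by
    intro z' w' h1 h2
    have hz' : (((D⁻¹ : ℝ) : ℂ) * z').im = p := by rw [im_ofReal_mul, h1]; field_simp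
    have hw' : ((D : ℂ) * w').im = q := by rw [im_ofReal_mul, h2]; field_simp
    have h := hG.norm_scale_zpow n ((D⁻¹ : ℝ) * z') (D * w') (by rw [hz']; exact hp0)
      (by rw [hw']; exact hq0)
    rw [zpow_neg, zpow_natCast, ← hD, ← mul_assoc, ← mul_assoc, ← ofReal_mul,
      ← ofReal_mul, inv_mul_cancel₀ hD0.ne', mul_inv_cancel₀ hD0.ne', ofReal_one, one_mul,
      one_mul, ← hX] at h
    rw [h]
    gcongr
    exact hC _ _ (hz' ▸ hpm) (hw' ▸ hqm)
  have main := hG.norm_le_interp (s := 1 / 3) (by positivity) (by positivity) (by positivity)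
    (by positivity) (by norm_num) hA hB (z := z) (w := w)
    (by
      have : z.im = p * c₁ := by rw [hp]; field_simp
      rw [this, hc₁]; ring)
    (by
      have : w.im = q * c₂ := by rw [hq]; field_simp
      rw [this, hc₂]; ring)
  -- The exponents combine as `X^(-2/3) X^(1/3) = X^(-1/3)`. A parameter below `1/2` is what makes
  -- the net exponent negative.
  refine main.trans_eq ?_
  rw [Real.mul_rpow (by positivity) hC0, Real.mul_rpow (by positivity) hC0, Real.inv_rpow hX0.le,
    ← Real.rpow_neg hX0.le, mul_mul_mul_comm, ← Real.rpow_add hX0, ← Real.rpow_add_of_nonneg hC0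
    (by norm_num) (by norm_num)]
  norm_num
  rw [mul_comm]

lemma exists_norm_le_const (hG : CuspInvariant k₁ k₂ G N a b δ) (hk : k₁ ≤ k₂) {R : ℝ}
    (hR : 1 ≤ R) :
    ∃ C : ℝ, 0 ≤ C ∧ ∀ z w : ℂ, 1 ≤ z.im → w.im ≤ R * z.im → z.im ≤ R * w.im → ‖G z w‖ ≤ C := by
  obtain ⟨C, hC0, hC⟩ := hG.exists_norm_le hR
  refine ⟨C, hC0, fun z w h1 h2 h3 => ?_⟩
  obtain ⟨n, -, hn⟩ := hC z w h1 h2 h3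
  refine hn.trans (mul_le_of_le_one_right hC0
    (Real.rpow_le_one_of_one_le_of_nonpos ?_ (by norm_num)))
  exact one_le_zpow₀ (Real.one_le_sqrt.2 hG.one_lt.le) (by have := sub_nonneg.2 hk; positivity)

lemma exists_norm_le_of_le_im (hG : CuspInvariant k₁ k₂ G N a b δ) (hk : k₁ < k₂) {R : ℝ}
    (hR : 1 ≤ R) {ε : ℝ} (hε : 0 < ε) :
    ∃ T : ℝ, ∀ z w : ℂ, 1 ≤ z.im → w.im ≤ R * z.im → z.im ≤ R * w.im → T ≤ z.im →
      ‖G z w‖ ≤ ε := by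
  obtain ⟨C, hC0, hC⟩ := hG.exists_norm_le hR
  have hr : 1 < √δ := by rw [Real.lt_sqrt (by norm_num)]; simpa using hG.one_lt
  have hlim : Tendsto (fun n : ℕ => C * (√δ ^ n) ^ (-(1 / 3 : ℝ))) atTop (𝓝 (C * 0)) :=
    ((tendsto_rpow_neg_atTop (by norm_num)).comp
      (tendsto_pow_atTop_atTop_of_one_lt hr)).const_mul C
  rw [mul_zero] at hlim
  obtain ⟨m, hm⟩ := eventually_atTop.1 (hlim.eventually (ge_mem_nhds hε))
  refine ⟨δ ^ (m + 1), fun z w h1 h2 h3 h4 => ?_⟩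
  obtain ⟨n, hn1, hn⟩ := hC z w h1 h2 h3
  have hmn : m ≤ n := by
    have := (pow_le_pow_iff_right₀ hG.one_lt).1 (h4.trans hn1)
    omega
  refine hn.trans (le_trans ?_ (hm n hmn))
  gcongr C * ?_
  apply Real.rpow_le_rpow_of_nonpos (by positivity) _ (by norm_num)
  rw [← zpow_natCast]
  apply zpow_le_zpow_right₀ hr.le
  have : 1 ≤ k₂ - k₁ := by omega
  nlinarith

/-- Exponential decay in a Siegel domain. -/
lemma exists_norm_le_exp (hG : CuspInvariant k₁ k₂ G N a b δ) (hk : k₁ < k₂) {R : ℝ}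
    (hR : 1 ≤ R) :
    ∃ C c : ℝ, 0 ≤ C ∧ 0 < c ∧ ∀ z w : ℂ, 2 ≤ z.im → w.im ≤ R * z.im → z.im ≤ R * w.im →
      ‖G z w‖ ≤ C * Real.exp (-(c * z.im)) := by
  have hN := hG.pos
  have hR' : 1 ≤ 2 * R := by linarith
  obtain ⟨C, hC0, hC⟩ := hG.exists_norm_le_const hk.le hR'
  refine ⟨C, Real.pi / (R * N), hC0, by positivity, fun z w h1 h2 h3 => ?_⟩
  -- Lowering both points by `τ` costs at most half of each height, so the diagonal ray above them
  -- stays in a Siegel domain with constant `2R`. Climbing back by `τ` gains `exp(-2πτ/N) = exp(-π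
  -- Im z / (R N))`.
  set τ : ℝ := z.im / (2 * R) with hτ
  have hτ1 : τ ≤ z.im / 2 := by rw [hτ]; apply div_le_div_of_nonneg_left <;> linarith
  have hτ2 : τ ≤ w.im / 2 := by rw [hτ, div_le_iff₀ (by positivity)]; linarith
  have hτ0 : 0 < τ := by positivity
  have hreg : ∀ t : ℂ, 0 < t.im → 1 ≤ (z - τ * I + t).im ∧
      (w - τ * I + t).im ≤ 2 * R * (z - τ * I + t).im ∧
      (z - τ * I + t).im ≤ 2 * R * (w - τ * I + t).im ∧ t.im ≤ (z - τ * I + t).im ∧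
      0 < (w - τ * I + t).im := by
    intro t ht
    have e1 : (z - τ * I + t).im = z.im - τ + t.im := by simp
    have e2 : (w - τ * I + t).im = w.im - τ + t.im := by simp
    rw [e1, e2]
    refine ⟨by linarith, ?_, ?_, by linarith, by linarith⟩
    · nlinarith [mul_nonneg (sub_nonneg.2 hR) ht.le]
    · nlinarith [mul_nonneg (sub_nonneg.2 hR) ht.le]
  have main := norm_le_exp_of_periodic hN (C := C)
    (h := fun t => G (z - τ * I + t) (w - τ * I + t)) ?_ ?_ ?_ ?_ (t := τ * I) (by simpa using hτ0)
  · simp only [sub_add_cancel] at main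
    have e : ((τ : ℂ) * I).im = τ := by simp
    rw [e] at main
    convert main using 3
    rw [hτ]; field_simp
  · exact hG.holo.differentiableOn _ _ _ (isOpen_lt continuous_const continuous_im)
      (by fun_prop) (by fun_prop)
      (fun t ht => ⟨by linarith [(hreg t ht).1], (hreg t ht).2.2.2.2⟩)
  · intro t ht
    have := hG.periodic_diag (z - τ * I + t) (w - τ * I + t)
      (by linarith [(hreg t ht).1]) (hreg t ht).2.2.2.2
    simpa only [add_assoc] using this
  · intro t ht
    exact hC _ _ (hreg t ht).1 (hreg t ht).2.1 (hreg t ht).2.2.1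
  · rw [Metric.tendsto_nhds]
    intro ε hε
    obtain ⟨T, hT⟩ := hG.exists_norm_le_of_le_im hk hR' (half_pos hε)
    have hev : ∀ᶠ t : ℂ in comap im atTop, max T 1 ≤ t.im :=
      preimage_mem_comap (Ici_mem_atTop _)
    filter_upwards [hev] with t ht
    have ht0 : 0 < t.im := one_pos.trans_le ((le_max_right _ _).trans ht)
    obtain ⟨g1, g2, g3, g4, -⟩ := hreg t ht0
    rw [dist_zero_right]
    exact (hT _ _ g1 g2 g3 ((le_max_left _ _).trans (ht.trans g4))).trans_lt (half_lt_self hε)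

/-- The hyperbolic element preserves the product of the heights and changes their ratio by `δ²`, so
a power of it brings the ratio into `[1, δ²)`. -/
lemma exists_siegel (hG : CuspInvariant k₁ k₂ G N a b δ) (z w : ℂ) (hz : 0 < z.im)
    (hw : 0 < w.im) : ∃ z' w' : ℂ, petersson k₁ k₂ G z' w' = petersson k₁ k₂ G z w ∧
      z'.im * w'.im = z.im * w.im ∧ 0 < z'.im ∧ 0 < w'.im ∧ w'.im ≤ z'.im ∧
      z'.im ≤ δ ^ 2 * w'.im := by
  have hδ : 0 < δ := one_pos.trans hG.one_lt
  obtain ⟨n, hn1, hn2⟩ := exists_mem_Ico_zpow (div_pos hz hw) (one_lt_pow₀ hG.one_lt two_ne_zero)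
  refine ⟨(δ ^ (-n) : ℝ) * z, (δ ^ (- -n) : ℝ) * w, hG.scale_zpow (-n) z w hz hw, ?_⟩
  rw [im_ofReal_mul, im_ofReal_mul, neg_neg, zpow_neg]
  set D := δ ^ n with hD
  have hD0 : 0 < D := zpow_pos hδ _
  have e : (δ ^ 2) ^ n = D * D := by rw [hD, ← mul_zpow, pow_two]
  rw [zpow_add_one₀ (by positivity), e, div_lt_iff₀ hw] at hn2
  rw [e, le_div_iff₀ hw] at hn1
  refine ⟨by field_simp, by positivity, by positivity, ?_, ?_⟩
  · rw [le_inv_mul_iff₀ hD0]; linarith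
  · rw [inv_mul_le_iff₀ hD0]; nlinarith

/-- Once the heights are comparable, exponential decay beats the powers of the heights when `k₁ <
k₂`. When `k₁ = k₂ < 0`, `G` is merely bounded and the negative powers tend to zero. -/
lemma petersson_tendsto_zero (hG : CuspInvariant k₁ k₂ G N a b δ)
    (hk : k₁ < k₂ ∨ (k₁ = k₂ ∧ k₁ < 0)) {ε : ℝ} (hε : 0 < ε) :
    ∃ T : ℝ, ∀ z w : ℂ, 0 < z.im → 0 < w.im → T ≤ z.im * w.im → petersson k₁ k₂ G z w ≤ ε := by
  have hδ1 := hG.one_lt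
  have hδ : 0 < δ := one_pos.trans hδ1
  have hδ2 : 1 ≤ δ ^ 2 := one_le_pow₀ hδ1.le
  suffices ∃ T : ℝ, 0 ≤ T ∧ ∀ z w : ℂ, 0 < z.im → 0 < w.im → w.im ≤ z.im → z.im ≤ δ ^ 2 * w.im →
      T ≤ z.im → petersson k₁ k₂ G z w ≤ ε by
    obtain ⟨T, hT0, hT⟩ := this
    refine ⟨T ^ 2, fun z w hz hw h => ?_⟩
    obtain ⟨z', w', h1, h2, h3, h4, h5, h6⟩ := hG.exists_siegel z w hz hw
    rw [← h1]
    refine hT z' w' h3 h4 h5 h6 ?_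
    rw [← h2] at h
    exact abs_le_of_sq_le_sq' (by nlinarith) h3.le |>.2
  rcases hk with hk | ⟨rfl, hk⟩
  · obtain ⟨C, c, hC0, hc, hC⟩ := hG.exists_norm_le_exp hk hδ2
    set K := k₁.natAbs + k₂.natAbs with hK
    have hlim : Tendsto (fun x : ℝ => C * (x ^ K * Real.exp (-c * x))) atTop (𝓝 (C * 0)) := by
      refine Tendsto.const_mul C ?_
      simpa using tendsto_rpow_mul_exp_neg_mul_atTop_nhds_zero (K : ℝ) c hc
    rw [mul_zero] at hlim
    obtain ⟨T, hT⟩ := eventually_atTop.1 (hlim.eventually (ge_mem_nhds hε))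
    refine ⟨max T (2 * δ ^ 2), by positivity, fun z w hz hw h1 h2 h3 => ?_⟩
    have hz2 : 2 * δ ^ 2 ≤ z.im := (le_max_right _ _).trans h3
    have hw1 : 1 ≤ w.im := by
      by_contra! h
      nlinarith
    have hz1 : 2 ≤ z.im := by nlinarith
    refine le_trans ?_ (hT z.im ((le_max_left _ _).trans h3))
    have hsq : ∀ (y : ℝ) (k : ℤ), 1 ≤ y → √y ^ k ≤ y ^ k.natAbs := by
      intro y k hy
      have hs1 : 1 ≤ √y := Real.one_le_sqrt.2 hy
      calc √y ^ k ≤ √y ^ (k.natAbs : ℤ) := zpow_le_zpow_right₀ hs1 Int.le_natAbs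
        _ = √y ^ k.natAbs := zpow_natCast _ _
        _ ≤ y ^ k.natAbs := by
          gcongr
          rw [Real.sqrt_le_left (by linarith)]
          nlinarith
    unfold petersson
    calc ‖G z w‖ * √z.im ^ k₁ * √w.im ^ k₂
        ≤ (C * Real.exp (-(c * z.im))) * z.im ^ k₁.natAbs * w.im ^ k₂.natAbs := by
          gcongr
          · exact hC z w hz1 (h1.trans (le_mul_of_one_le_left hz.le hδ2)) h2
          · exact hsq _ _ (by linarith)
          · exact hsq _ _ hw1
      _ ≤ (C * Real.exp (-(c * z.im))) * z.im ^ k₁.natAbs * z.im ^ k₂.natAbs := by gcongr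
      _ = _ := by rw [hK, pow_add, neg_mul]; ring
  · obtain ⟨C, hC0, hC⟩ := hG.exists_norm_le_const le_rfl hδ2
    have hlim : Tendsto (fun x : ℝ => C * (√x) ^ k₁) atTop (𝓝 (C * 0)) :=
      ((tendsto_zpow_atTop_zero hk).comp Real.tendsto_sqrt_atTop).const_mul C
    rw [mul_zero] at hlim
    obtain ⟨T, hT⟩ := eventually_atTop.1 (hlim.eventually (ge_mem_nhds hε))
    refine ⟨max T (δ ^ 2), by positivity, fun z w hz hw h1 h2 h3 => ?_⟩
    have hz2 : δ ^ 2 ≤ z.im := (le_max_right _ _).trans h3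
    have hw1 : 1 ≤ w.im := by
      by_contra! h
      nlinarith
    refine le_trans ?_ (hT z.im ((le_max_left _ _).trans h3))
    unfold petersson
    calc ‖G z w‖ * √z.im ^ k₁ * √w.im ^ k₁ ≤ C * √z.im ^ k₁ * 1 := by
          gcongr
          · exact hC z w (hδ2.trans hz2) (h1.trans (le_mul_of_one_le_left hz.le hδ2)) h2
          · exact zpow_le_one_of_nonpos₀ (Real.one_le_sqrt.2 hw1) hk.le
      _ = _ := by rw [mul_one]

/-- Large values of the Petersson norm above a given height are taken on a compact set. -/
lemma exists_compact (hG : CuspInvariant k₁ k₂ G N a b δ)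
    (hk : k₁ < k₂ ∨ (k₁ = k₂ ∧ k₁ < 0)) {ε c : ℝ} (hε : 0 < ε) (hc : 0 < c) :
    ∃ K : Set (ℂ × ℂ), IsCompact K ∧ K ⊆ {p | 0 < p.1.im ∧ 0 < p.2.im} ∧
      ∀ z w : ℂ, 0 < z.im → 0 < w.im → c ≤ z.im * w.im →
        petersson k₁ k₂ G z w ≤ ε ∨
          ∃ p ∈ K, petersson k₁ k₂ G p.1 p.2 = petersson k₁ k₂ G z w := by
  have hδ1 := hG.one_lt
  have hδ : 0 < δ := one_pos.trans hδ1
  have hδ2 : 1 ≤ δ ^ 2 := one_le_pow₀ hδ1.le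
  obtain ⟨T, hT⟩ := hG.petersson_tendsto_zero hk hε
  obtain ⟨B, hB⟩ := hG.exists_translate
  have hl : 0 < √c / δ ^ 2 := by positivity
  -- After `exists_siegel`, `c ≤ y₁ y₂ ≤ y₁²` and `y₁² ≤ δ² y₁ y₂` bound the larger height `y₁` on
  -- both sides; the smaller is at least `y₁ / δ²`.
  refine ⟨_, isCompact_box (l := √c / δ ^ 2) (u := δ * √(max T 0)) (B := B),
    fun p hp => ⟨hl.trans_le hp.2.2.1.1, hl.trans_le hp.2.2.2.1⟩, fun z w hz hw h => ?_⟩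
  by_cases hzw : T ≤ z.im * w.im
  · exact Or.inl (hT z w hz hw hzw)
  right
  obtain ⟨z', w', h1, h2, h3, h4, h5, h6⟩ := hG.exists_siegel z w hz hw
  obtain ⟨z'', w'', e1, e2, b1, b2, hz''⟩ := hB z' w' h3 h4
  have hlow : √c ≤ z'.im := by
    rw [Real.sqrt_le_left h3.le]
    nlinarith
  have hlow' : √c / δ ^ 2 ≤ w'.im := by
    rw [div_le_iff₀ (by positivity)]; linarith
  have hup : z'.im ≤ δ * √(max T 0) := by
    apply abs_le_of_sq_le_sq' _ (by positivity) |>.2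
    rw [mul_pow, Real.sq_sqrt (le_max_right _ _)]
    have : z'.im * w'.im ≤ max T 0 := by rw [h2]; exact (not_le.1 hzw).le.trans (le_max_left _ _)
    nlinarith
  refine ⟨(z'', w''), ⟨b1, b2, ?_, ?_⟩, ?_⟩
  · rw [e1]; exact ⟨(div_le_self (Real.sqrt_nonneg _) hδ2).trans hlow, hup⟩
  · rw [e2]; exact ⟨hlow', h5.trans hup⟩
  · rw [← h1]; simp only [petersson, e1, e2, hz'']

end CuspInvariant

/-! ### Maximum principle on a slice -/

/-- If the Petersson norm has a maximum along a horizontal slice where it tends to zero, and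
`k₁ ≤ 0`, then the maximum is zero. -/
lemma CurveHolomorphic.eq_zero_of_isMax {k₁ k₂ : ℤ} {G : ℂ → ℂ → ℂ} (hG : CurveHolomorphic G)
    (hk : k₁ ≤ 0) {p q : ℂ} (hp : 0 < p.im) (hq : 0 < q.im)
    (hmax : ∀ z : ℂ, 0 < z.im → petersson k₁ k₂ G z q ≤ petersson k₁ k₂ G p q)
    (hlim : ∀ ε > 0, ∃ T : ℝ, ∀ z : ℂ, 0 < z.im → T ≤ z.im → petersson k₁ k₂ G z q ≤ ε) :
    G p q = 0 := by
  obtain ⟨n, hn⟩ := Int.eq_ofNat_of_zero_le (neg_nonneg.2 hk)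
  obtain rfl : k₁ = -(n : ℤ) := by omega
  set U : Set ℂ := {z | 0 < z.im} with hU
  have hUo : IsOpen U := isOpen_lt continuous_const continuous_im
  set p' : ℂ := (starRingEnd ℂ) p with hp'
  have him : ∀ z : ℂ, (z - p').im = z.im + p.im := fun z => by simp [hp']
  have hge : ∀ z ∈ U, z.im + p.im ≤ ‖z - p'‖ := fun z hz =>
    (him z) ▸ (le_abs_self _).trans (abs_im_le_norm _)
  have hne : ∀ z ∈ U, z - p' ≠ 0 := by
    intro z hz h
    have := him z
    rw [h, zero_im] at this
    have hz : 0 < z.im := hz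
    linarith
  set h : ℂ → ℂ := fun z => G z q / (z - p') ^ n with hh
  have hd : DifferentiableOn ℂ h U := by
    refine (hG.differentiableOn U (fun z => z) (fun _ => q) hUo differentiableOn_id
      (differentiableOn_const q) fun z hz => ⟨hz, hq⟩).div (by fun_prop) fun z hz => ?_
    exact pow_ne_zero _ (hne z hz)
  have hsp : 0 < √p.im := Real.sqrt_pos.2 hp
  have hpp : ‖p - p'‖ = 2 * (√p.im * √p.im) := by
    rw [Real.mul_self_sqrt hp.le]
    have : p - p' = (2 * p.im : ℝ) * I := by
      apply Complex.ext <;> simp [hp']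
      ring
    rw [this, norm_mul, norm_I, mul_one, norm_real, Real.norm_of_nonneg (by positivity)]
  have hle : ∀ z ∈ U, ‖h z‖ ≤ ‖h p‖ := by
    intro z hz
    have hz' : 0 < z.im := hz
    have hsz : 0 < √z.im := Real.sqrt_pos.2 hz
    have h1 := hmax z hz
    unfold petersson at h1
    rw [mul_le_mul_iff_left₀ (zpow_pos (Real.sqrt_pos.2 hq) _), zpow_neg, zpow_neg, zpow_natCast,
      zpow_natCast, ← div_eq_mul_inv, ← div_eq_mul_inv, div_le_iff₀ (by positivity)] at h1
    -- The arithmetic-geometric mean inequality, with equality at `z = p`: this is why dividing by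
    -- `(z - p̄)^n` keeps the maximum at `p`.
    have h2 : 2 * (√z.im * √p.im) ≤ ‖z - p'‖ := by
      refine le_trans ?_ (hge z hz)
      nlinarith [sq_nonneg (√z.im - √p.im), Real.sq_sqrt hz'.le, Real.sq_sqrt hp.le]
    rw [hh]
    simp only [norm_div, norm_pow]
    rw [hpp]
    calc ‖G z q‖ / ‖z - p'‖ ^ n
        ≤ (‖G p q‖ / √p.im ^ n * √z.im ^ n) / (2 * (√z.im * √p.im)) ^ n := by gcongr
      _ = _ := by
        rw [mul_pow, mul_pow, mul_pow, mul_pow]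
        field_simp
  have hconst := Complex.eqOn_of_isPreconnected_of_isMaxOn_norm
    (convex_halfSpace_im_gt 0).isPreconnected hUo hd (show p ∈ U from hp) (fun z hz => hle z hz)
  have hc0 : 0 < √q.im ^ k₂ := zpow_pos (Real.sqrt_pos.2 hq) _
  -- As `h` is constant, the Petersson norm at `iY` is `‖h p‖ (|iY - p̄| / √Y)^n √(Im q)^k₂`, and
  -- the middle factor is at least `1` for `Y ≥ 1`.
  have hzero : ‖h p‖ * √q.im ^ k₂ ≤ 0 := by
    refine le_of_forall_pos_le_add fun ε hε => ?_
    rw [zero_add]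
    obtain ⟨T, hT⟩ := hlim ε hε
    set Y : ℝ := max T 1 with hY
    have hY1 : 1 ≤ Y := le_max_right _ _
    have hYi : ((Y : ℂ) * I).im = Y := by simp
    have hYU : (Y : ℂ) * I ∈ U := by
      change 0 < ((Y : ℂ) * I).im
      rw [hYi]; linarith
    refine le_trans ?_ (hT (Y * I) hYU (by rw [hYi]; exact le_max_left _ _))
    unfold petersson
    gcongr
    have e : h (Y * I) = h p := hconst hYU
    have e2 : G (Y * I) q = h p * (Y * I - p') ^ n := by
      rw [← e, hh]
      field_simp [pow_ne_zero n (hne _ hYU)]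
    rw [e2, hYi, norm_mul, norm_pow, zpow_neg, zpow_natCast, mul_assoc]
    refine le_mul_of_one_le_right (norm_nonneg _) ?_
    have hs0 : 0 < √Y := Real.sqrt_pos.2 (by linarith)
    rw [← div_eq_mul_inv, one_le_div (by positivity)]
    gcongr
    have := hge _ hYU
    rw [hYi] at this
    refine le_trans ?_ this
    have : √Y ≤ Y := by
      rw [Real.sqrt_le_left (by linarith)]
      nlinarith
    linarith
  have : ‖h p‖ = 0 := by
    have := norm_nonneg (h p)
    nlinarith
  have hp0 : h p = 0 := norm_eq_zero.1 this
  rw [hh] at hp0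
  simpa [pow_ne_zero n (hne p hp)] using hp0

/-! ### Differentiation in the first variable -/

/-- The derivative with respect to the first variable. -/
noncomputable def deriv₁ (G : ℂ → ℂ → ℂ) (z w : ℂ) : ℂ := deriv (fun t => G t w) z

/-- The Schwarz lemma applied twice, to `g` and then to its divided difference. The bound depends
only on `M` and `r`, hence is uniform over compact sets. -/
lemma norm_slope_sub_deriv_le {g : ℂ → ℂ} {z h : ℂ} {r M : ℝ} (hr : 0 < r)
    (hd : DifferentiableOn ℂ g (Metric.ball z r)) (hM : ∀ t ∈ Metric.ball z r, ‖g t‖ ≤ M)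
    (hh : ‖h‖ < r) (h0 : h ≠ 0) :
    ‖h⁻¹ * (g (z + h) - g z) - deriv g z‖ ≤ 4 * M / r / r * ‖h‖ := by
  have hzm : z ∈ Metric.ball z r := Metric.mem_ball_self hr
  have hm : z + h ∈ Metric.ball z r := by simpa using hh
  have h1 : MapsTo g (Metric.ball z r) (Metric.closedBall (g z) (2 * M)) := by
    intro t ht
    rw [mem_closedBall_iff_norm]
    linarith [norm_sub_le (g t) (g z), hM t ht, hM z hzm]
  have hb : ∀ t ∈ Metric.ball z r, ‖dslope g z t‖ ≤ 2 * M / r := fun t ht =>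
    Complex.norm_dslope_le_div_of_mapsTo_ball hd h1 ht
  have hd2 : DifferentiableOn ℂ (dslope g z) (Metric.ball z r) :=
    (Complex.differentiableOn_dslope (Metric.ball_mem_nhds z hr)).2 hd
  have h2 : MapsTo (dslope g z) (Metric.ball z r)
      (Metric.closedBall (dslope g z z) (4 * M / r)) := by
    intro t ht
    rw [mem_closedBall_iff_norm]
    have e : 4 * M / r = 2 * M / r + 2 * M / r := by ring
    rw [e]
    linarith [norm_sub_le (dslope g z t) (dslope g z z), hb t ht, hb z hzm]
  have := Complex.dist_le_div_mul_dist_of_mapsTo_ball hd2 h2 hm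
  rw [dslope_same, dslope_of_ne _ (by simpa using h0), slope_def_module, dist_eq_norm,
    dist_eq_norm, add_sub_cancel_left, smul_eq_mul] at this
  exact this

lemma CurveHolomorphic.differentiableOn_left {G : ℂ → ℂ → ℂ} (hG : CurveHolomorphic G) {w : ℂ}
    (hw : 0 < w.im) : DifferentiableOn ℂ (fun t => G t w) {t | 0 < t.im} :=
  hG.differentiableOn _ (fun t => t) (fun _ => w) (isOpen_lt continuous_const continuous_im)
    differentiableOn_id (differentiableOn_const w) fun _ ht => ⟨ht, hw⟩

lemma isOpen_halfPlane_prod : IsOpen {p : ℂ × ℂ | 0 < p.1.im ∧ 0 < p.2.im} :=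
  (isOpen_lt continuous_const (continuous_im.comp continuous_fst)).inter
    (isOpen_lt continuous_const (continuous_im.comp continuous_snd))

lemma CurveHolomorphic.tendsto_deriv₁ {G : ℂ → ℂ → ℂ} (hG : CurveHolomorphic G) :
    TendstoLocallyUniformlyOn
      (fun (n : ℕ) (p : ℂ × ℂ) =>
        ((1 / ((n : ℝ) + 1) : ℝ) : ℂ)⁻¹ * (G (p.1 + (1 / ((n : ℝ) + 1) : ℝ)) p.2 - G p.1 p.2))
      (fun p => deriv₁ G p.1 p.2) atTop {p | 0 < p.1.im ∧ 0 < p.2.im} := by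
  rw [tendstoLocallyUniformlyOn_iff_forall_isCompact isOpen_halfPlane_prod]
  intro K hKU hK
  rw [Metric.tendstoUniformlyOn_iff]
  intro ε hε
  obtain rfl | hne := K.eq_empty_or_nonempty
  · simp
  obtain ⟨p₀, hp₀, hmin⟩ := hK.exists_isMinOn hne
    (continuous_im.comp continuous_fst).continuousOn
  -- Half the least first height on `K`, so that discs of radius `r` in the first variable around
  -- `K` remain in the half-plane.
  set r : ℝ := p₀.1.im / 2 with hr
  have hr0 : 0 < r := half_pos (hKU hp₀).1
  have hKc : IsCompact ((fun x : (ℂ × ℂ) × ℂ => (x.1.1 + x.2, x.1.2)) ''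
      (K ×ˢ Metric.closedBall 0 r)) :=
    (hK.prod (isCompact_closedBall _ _)).image (by fun_prop)
  obtain ⟨M, hM⟩ := hKc.exists_bound_of_continuousOn (hG.continuousOn.mono (by
    rintro _ ⟨⟨p, t⟩, ⟨hp, ht⟩, rfl⟩
    refine ⟨?_, (hKU hp).2⟩
    have h1 : p₀.1.im ≤ p.1.im := hmin hp
    have h2 : |t.im| ≤ r := (abs_im_le_norm t).trans (by simpa using ht)
    have h3 := (abs_le.1 h2).1
    have h4 := (hKU hp₀).1
    change 0 < (p.1 + t).im
    rw [add_im]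
    linarith))
  have hlim : Tendsto (fun n : ℕ => 4 * M / r / r * (1 / ((n : ℝ) + 1))) atTop
      (𝓝 (4 * M / r / r * 0)) := tendsto_one_div_add_atTop_nhds_zero_nat.const_mul _
  rw [mul_zero] at hlim
  filter_upwards [hlim.eventually (gt_mem_nhds hε),
    tendsto_one_div_add_atTop_nhds_zero_nat.eventually (gt_mem_nhds hr0)] with n hn1 hn2 p hp
  have hpos : (0 : ℝ) < 1 / ((n : ℝ) + 1) := by positivity
  rw [dist_comm, dist_eq_norm]
  have hball : Metric.ball p.1 r ⊆ {t : ℂ | 0 < t.im} := by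
    intro t ht
    have h1 : p₀.1.im ≤ p.1.im := hmin hp
    have h2 : |(t - p.1).im| ≤ r := (abs_im_le_norm _).trans (mem_ball_iff_norm.1 ht).le
    rw [sub_im] at h2
    have h3 := (abs_le.1 h2).1
    have h4 := (hKU hp₀).1
    change 0 < t.im
    linarith
  have := norm_slope_sub_deriv_le (h := ((1 / ((n : ℝ) + 1) : ℝ) : ℂ)) (M := M) hr0
    ((hG.differentiableOn_left (hKU hp).2).mono hball) (fun t ht => ?_)
    (by rw [norm_real, Real.norm_of_nonneg hpos.le]; exact hn2)
    (by exact_mod_cast hpos.ne')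
  · rw [norm_real, Real.norm_of_nonneg hpos.le] at this
    exact this.trans_lt hn1
  · refine hM (t, p.2) ⟨(p, t - p.1), ⟨hp, ?_⟩, by simp⟩
    simpa using (mem_ball_iff_norm.1 ht).le

/-- Difference quotients along real steps are holomorphic on curves and converge locally uniformly,
so Weierstrass' theorem applies along each curve. -/
lemma CurveHolomorphic.deriv₁ {G : ℂ → ℂ → ℂ} (hG : CurveHolomorphic G) :
    CurveHolomorphic (deriv₁ G) := by
  have hshift : ∀ n : ℕ, ContinuousOn (fun p : ℂ × ℂ => G (p.1 + (1 / ((n : ℝ) + 1) : ℝ)) p.2)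
      {p | 0 < p.1.im ∧ 0 < p.2.im} := by
    intro n
    refine hG.continuousOn.comp (f := fun p : ℂ × ℂ => (p.1 + ((1 / ((n : ℝ) + 1) : ℝ) : ℂ), p.2))
      (by fun_prop) fun p hp => ?_
    exact ⟨by simpa only [add_im, ofReal_im, add_zero] using hp.1, hp.2⟩
  constructor
  · exact hG.tendsto_deriv₁.continuousOn (Frequently.of_forall fun n =>
      continuousOn_const.mul ((hshift n).sub hG.continuousOn))
  · intro V α β hV hα hβ h
    have hcomp := hG.tendsto_deriv₁.comp (fun t => (α t, β t)) (fun t ht => h t ht)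
      (hα.continuousOn.prodMk hβ.continuousOn)
    refine hcomp.differentiableOn (Eventually.of_forall fun n => ?_) hV
    refine DifferentiableOn.mul (differentiableOn_const _) (DifferentiableOn.sub ?_ ?_)
    · refine hG.differentiableOn V (fun t => α t + ((1 / ((n : ℝ) + 1) : ℝ) : ℂ)) β hV
        (hα.add_const _) hβ fun t ht => ?_
      exact ⟨by simpa only [add_im, ofReal_im, add_zero] using (h t ht).1, (h t ht).2⟩
    · exact hG.differentiableOn V α β hV hα hβ h

/-! ### Minkowski's theorem on linear forms -/

section Minkowski

open MeasureTheory

/-- Minkowski's theorem on linear forms. -/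
lemma exists_int_vecMul_le {ι : Type*} [Fintype ι] [DecidableEq ι] (A : Matrix ι ι ℝ)
    (hA : A.det ≠ 0) {r : ℝ} (hr : 0 < r) (h : |A.det| < r ^ Fintype.card ι) :
    ∃ v : ι → ℤ, v ≠ 0 ∧ ∀ i, |∑ j, (v j : ℝ) * A j i| ≤ r := by
  have hu : IsUnit A := (Matrix.isUnit_iff_isUnit_det A).2 (isUnit_iff_ne_zero.2 hA)
  have hli : LinearIndependent ℝ (fun i => A i) := Matrix.linearIndependent_rows_of_isUnit hu
  have hsp : ⊤ ≤ Submodule.span ℝ (range fun i => A i) := by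
    rw [hli.span_eq_top_of_card_eq_finrank' (by simp)]
  set b : Module.Basis ι ℝ (ι → ℝ) := Module.Basis.mk hli hsp with hb
  have hbA : ∀ i, b i = A i := fun i => by rw [hb, Module.Basis.mk_apply]
  have hdet : (Matrix.of b).det = A.det := by
    congr 1
    ext i j
    simp [hbA]
  have hvol : volume (Metric.closedBall (0 : ι → ℝ) r) =
      ENNReal.ofReal ((2 * r) ^ Fintype.card ι) := Real.volume_pi_closedBall _ hr.le
  have : Countable (Submodule.span ℤ (range b)).toAddSubgroup :=
    inferInstanceAs (Countable (Submodule.span ℤ (range b)))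
  obtain ⟨x, hx0, hx⟩ := exists_ne_zero_mem_lattice_of_measure_mul_two_pow_lt_measure
    (μ := volume) (s := Metric.closedBall (0 : ι → ℝ) r) (ZSpan.isAddFundamentalDomain' b volume)
    (fun x hx => by simpa using hx) (convex_closedBall _ _) (by
      rw [ZSpan.volume_fundamentalDomain, hdet, hvol, Module.finrank_fintype_fun_eq_card, mul_pow,
        mul_comm, ENNReal.ofReal_mul (by positivity), ENNReal.ofReal_pow (by norm_num)]
      have h2 : ENNReal.ofReal 2 = 2 := by simp
      rw [h2]
      exact ENNReal.mul_lt_mul_right (by simp) (by finiteness)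
        ((ENNReal.ofReal_lt_ofReal_iff (by positivity)).2 h))
  obtain ⟨v, hv⟩ := (Submodule.mem_span_range_iff_exists_fun ℤ).1 x.2
  refine ⟨v, ?_, fun i => ?_⟩
  · rintro rfl
    apply hx0
    ext1
    simpa using hv.symm
  · have h1 := (norm_le_pi_norm (x : ι → ℝ) i).trans (mem_closedBall_zero_iff.1 hx)
    rw [← hv, Real.norm_eq_abs] at h1
    simpa [Finset.sum_apply, hbA] using h1

end Minkowski

/-! ### Arithmetic of the field: norms, units, small pairs, Bézout relations -/

lemma span_pair_ne_bot {R : Type*} [CommRing R] {c d : R} (h : c ≠ 0 ∨ d ≠ 0) :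
    Ideal.span {c, d} ≠ ⊥ := by
  rw [Ne, Ideal.span_eq_bot]
  push Not
  rcases h with h | h
  · exact ⟨c, by simp, h⟩
  · exact ⟨d, by simp, h⟩

section Field

variable {F : Type*} [Field F] [NumberField F]

lemma norm_eq_mul (hF : Module.finrank ℚ F = 2) {σ₁ σ₂ : F →+* ℝ} (hσ : σ₁ ≠ σ₂) (x : F) :
    ((Algebra.norm ℚ x : ℚ) : ℝ) = σ₁ x * σ₂ x := by
  classical
  set τ : (F →+* ℝ) → (F →ₐ[ℚ] ℂ) := fun σ => (Complex.ofRealHom.comp σ).toRatAlgHom with hτ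
  have hne : τ σ₁ ≠ τ σ₂ := by
    intro h
    apply hσ
    ext y
    have := DFunLike.congr_fun h y
    simpa [hτ] using this
  have huniv : (Finset.univ : Finset (F →ₐ[ℚ] ℂ)) = {τ σ₁, τ σ₂} := by
    symm
    apply Finset.eq_univ_of_card
    rw [Finset.card_pair hne, AlgHom.card, hF]
  have h := Algebra.norm_eq_prod_embeddings ℚ ℂ x
  rw [huniv, Finset.prod_pair hne] at h
  have h' : ((Algebra.norm ℚ x : ℚ) : ℂ) = (σ₁ x : ℂ) * (σ₂ x : ℂ) := by simpa [hτ] using h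
  exact_mod_cast h'

lemma abs_mul_units (hF : Module.finrank ℚ F = 2) {σ₁ σ₂ : F →+* ℝ} (hσ : σ₁ ≠ σ₂)
    (u : (𝓞 F)ˣ) : |σ₁ (u : F)| * |σ₂ (u : F)| = 1 := by
  have h := NumberField.Units.norm F u
  rw [← abs_mul, ← norm_eq_mul hF hσ]
  exact_mod_cast h

/-- Dirichlet's theorem gives a unit that is small at every place but that of `σ₁`, in particular at
`σ₂`; the norm is `±1`, so it is large at `σ₁`. -/
lemma exists_unit_one_lt (hF : Module.finrank ℚ F = 2) {σ₁ σ₂ : F →+* ℝ} (hσ : σ₁ ≠ σ₂) :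
    ∃ u : (𝓞 F)ˣ, 1 < |σ₁ (u : F)| := by
  obtain ⟨u, hu⟩ := NumberField.Units.dirichletUnitTheorem.exists_unit F
    (NumberField.InfinitePlace.mk (Complex.ofRealHom.comp σ₁))
  refine ⟨u, ?_⟩
  have hne : NumberField.InfinitePlace.mk (Complex.ofRealHom.comp σ₂) ≠
      NumberField.InfinitePlace.mk (Complex.ofRealHom.comp σ₁) := by
    intro h
    apply hσ
    ext y
    rcases NumberField.InfinitePlace.mk_eq_iff.1 h with h | h
    · have := DFunLike.congr_fun h y
      simp at this
      exact this.symm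
    · have := DFunLike.congr_fun h y
      simp [NumberField.ComplexEmbedding.conjugate_coe_eq] at this
      exact this.symm
  have h1 := hu _ hne
  rw [NumberField.InfinitePlace.apply] at h1
  have h2 : ‖(Complex.ofRealHom.comp σ₂) (u : F)‖ = |σ₂ (u : F)| := by simp
  rw [h2] at h1
  have h3 := abs_mul_units hF hσ u
  have h4 : 0 < |σ₂ (u : F)| := by
    rcases (abs_nonneg (σ₂ (u : F))).eq_or_lt with h | h
    · rw [← h, mul_zero] at h3; norm_num at h3
    · exact h
  have h5 := (Real.log_neg_iff h4).1 h1
  by_contra! h6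
  nlinarith [abs_nonneg (σ₁ (u : F))]

lemma exists_integer_ne {σ₁ σ₂ : F →+* ℝ} (hσ : σ₁ ≠ σ₂) :
    ∃ θ : 𝓞 F, σ₁ (θ : F) ≠ σ₂ (θ : F) := by
  by_contra! h
  apply hσ
  ext x
  obtain ⟨a, b, hb, rfl⟩ := IsFractionRing.div_surjective (A := 𝓞 F) x
  have h1 := h a
  have h2 := h b
  rw [map_div₀, map_div₀]
  exact congrArg₂ _ h1 h2

/-- Minkowski applied to pairs from the order `ℤ + ℤθ`, a lattice of rank four. The forms are
normalised by the heights so that the covolume does not depend on the point, whence the uniform `C`.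
-/
lemma exists_small_pair {σ₁ σ₂ : F →+* ℝ} (hσ : σ₁ ≠ σ₂) :
    ∃ C : ℝ, 0 < C ∧ ∀ z w : ℂ, 0 < z.im → 0 < w.im → ∃ c d : 𝓞 F, (c ≠ 0 ∨ d ≠ 0) ∧
      normSq ((σ₁ (c : F) : ℂ) * z + (σ₁ (d : F) : ℂ)) ≤ C * z.im ∧
      normSq ((σ₂ (c : F) : ℂ) * w + (σ₂ (d : F) : ℂ)) ≤ C * w.im := by
  obtain ⟨θ, hθ⟩ := exists_integer_ne hσ
  set t := σ₁ (θ : F) with ht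
  set t' := σ₂ (θ : F) with ht'
  set r : ℝ := 1 + (t - t') ^ 2 with hr
  have hr1 : 1 ≤ r := by rw [hr]; nlinarith [sq_nonneg (t - t')]
  refine ⟨2 * r ^ 2, by positivity, fun z w hz hw => ?_⟩
  set s := √z.im with hs
  set s' := √w.im with hs'
  have hs0 : 0 < s := Real.sqrt_pos.2 hz
  have hs0' : 0 < s' := Real.sqrt_pos.2 hw
  -- Rows: `c = 1`, `c = θ`, `d = 1`, `d = θ`. Columns: `c √y` and `(c x + d) / √y` at each
  -- embedding, whose squares sum to `|c z + d|² / y`.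
  set A : Matrix (Fin 4) (Fin 4) ℝ :=
    !![s, z.re / s, s', w.re / s'; t * s, t * z.re / s, t' * s', t' * w.re / s';
      0, 1 / s, 0, 1 / s'; 0, t / s, 0, t' / s'] with hA
  have hdet : A.det = -(t - t') ^ 2 := by
    rw [hA]
    simp [Matrix.det_succ_row_zero, Fin.sum_univ_succ, Fin.succAbove]
    field_simp
    ring
  have hne : A.det ≠ 0 := by rw [hdet]; exact neg_ne_zero.2 (pow_ne_zero _ (sub_ne_zero.2 hθ))
  obtain ⟨v, hv0, hv⟩ := exists_int_vecMul_le A hne (one_pos.trans_le hr1) (by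
    rw [hdet, abs_neg, abs_of_nonneg (sq_nonneg _), Fintype.card_fin]
    calc (t - t') ^ 2 < r := by rw [hr]; linarith
      _ ≤ r ^ 4 := le_self_pow₀ hr1 (by norm_num))
  have hint : ∀ (σ : F →+* ℝ) (m n : ℤ), σ (((m : 𝓞 F) + (n : 𝓞 F) * θ : 𝓞 F) : F) =
      m + n * σ (θ : F) := by
    intro σ m n
    simp
  have hzero : ∀ m n : ℤ, (m : 𝓞 F) + (n : 𝓞 F) * θ = 0 → m = 0 ∧ n = 0 := by
    intro m n h
    have h1 := hint σ₁ m n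
    have h2 := hint σ₂ m n
    rw [h] at h1 h2
    simp only [map_zero] at h1 h2
    have h3 : (n : ℝ) * (t - t') = 0 := by rw [ht, ht']; linarith
    have h4 : (n : ℝ) = 0 := (mul_eq_zero.1 h3).resolve_right (sub_ne_zero.2 hθ)
    rw [h4] at h1
    have h5 : (m : ℝ) = 0 := by linarith
    exact ⟨by exact_mod_cast h5, by exact_mod_cast h4⟩
  have bound : ∀ (c d : ℝ) (z : ℂ), 0 < z.im → |c * √z.im| ≤ r → |(c * z.re + d) / √z.im| ≤ r →
      normSq ((c : ℂ) * z + (d : ℂ)) ≤ 2 * r ^ 2 * z.im := by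
    intro c d z hz h1 h2
    have h3 := sq_le_sq' (abs_le.1 h1).1 (abs_le.1 h1).2
    have h4 := sq_le_sq' (abs_le.1 h2).1 (abs_le.1 h2).2
    rw [mul_pow, Real.sq_sqrt hz.le] at h3
    rw [div_pow, Real.sq_sqrt hz.le, div_le_iff₀ hz] at h4
    rw [normSq_apply]
    simp only [add_re, mul_re, ofReal_re, ofReal_im, zero_mul, sub_zero, add_im, mul_im, add_zero]
    nlinarith
  refine ⟨v 0 + v 1 * θ, v 2 + v 3 * θ, ?_, ?_, ?_⟩
  · by_contra! h
    obtain ⟨h0, h1⟩ := hzero _ _ h.1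
    obtain ⟨h2, h3⟩ := hzero _ _ h.2
    apply hv0
    ext i
    fin_cases i <;> simp [h0, h1, h2, h3]
  · rw [hint, hint]
    apply bound _ _ _ hz
    · convert hv 0 using 2
      simp [hA, Fin.sum_univ_succ]; ring
    · convert hv 1 using 2
      simp [hA, Fin.sum_univ_succ]; ring
  · rw [hint, hint]
    apply bound _ _ _ hw
    · convert hv 2 using 2
      simp [hA, Fin.sum_univ_succ]; ring
    · convert hv 3 using 2
      simp [hA, Fin.sum_univ_succ]; ring

lemma mem_fullGroup {γ : SL(2, F)} (h : ∀ i j, ∃ x : 𝓞 F, (x : F) = γ i j) :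
    γ ∈ fullGroup F := by
  choose M hM using h
  have hdet : (Matrix.of M).det = 1 := by
    apply NumberField.RingOfIntegers.coe_injective
    have h1 := γ.det_coe
    rw [Matrix.det_fin_two] at h1 ⊢
    simp only [Matrix.of_apply, map_sub, map_mul, hM, map_one]
    exact h1
  refine ⟨⟨Matrix.of M, hdet⟩, ?_⟩
  ext i j
  exact hM i j

open scoped nonZeroDivisors in
-- The ideal `I = (c, d)` is invertible, so `1 ∈ I I⁻¹` yields `a, b ∈ I⁻¹`. Thus `(c, d)` is the
-- bottom row of a matrix in `SL₂(F)` even when `I` is not principal.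
lemma exists_bezout {c d : 𝓞 F} (h : c ≠ 0 ∨ d ≠ 0) :
    ∃ a b : F, a * d - b * c = 1 ∧ ∀ x ∈ Ideal.span {c, d},
      (∃ y : 𝓞 F, (y : F) = a * x) ∧ ∃ y : 𝓞 F, (y : F) = b * x := by
  set I : Ideal (𝓞 F) := Ideal.span {c, d} with hI
  have hI0 : I ≠ ⊥ := span_pair_ne_bot h
  set J : FractionalIdeal (𝓞 F)⁰ F := (I : FractionalIdeal (𝓞 F)⁰ F) with hJ
  have hJ0 : J ≠ 0 := FractionalIdeal.coeIdeal_ne_zero.2 hI0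
  have hmul : J * J⁻¹ = 1 := mul_inv_cancel₀ hJ0
  have hint : ∀ a ∈ J⁻¹, ∀ x ∈ I, ∃ y : 𝓞 F, (y : F) = a * x := by
    intro a ha x hx
    have h1 : (x : F) * a ∈ J * J⁻¹ :=
      FractionalIdeal.mul_mem_mul (FractionalIdeal.mem_coeIdeal_of_mem _ hx) ha
    rw [hmul, FractionalIdeal.mem_one_iff] at h1
    obtain ⟨y, hy⟩ := h1
    exact ⟨y, by rw [mul_comm]; exact hy⟩
  have hsum : J = FractionalIdeal.spanSingleton (𝓞 F)⁰ (c : F) +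
      FractionalIdeal.spanSingleton (𝓞 F)⁰ (d : F) := by
    rw [hJ, hI, Ideal.span_insert, FractionalIdeal.coeIdeal_sup,
      FractionalIdeal.coeIdeal_span_singleton, FractionalIdeal.coeIdeal_span_singleton]
  have h1 : (1 : F) ∈ J * J⁻¹ := by rw [hmul]; exact FractionalIdeal.one_mem_one _
  rw [hsum, add_mul, FractionalIdeal.mem_add, ← hsum] at h1
  obtain ⟨x, hx, y, hy, hxy⟩ := h1
  obtain ⟨b, hb, rfl⟩ := FractionalIdeal.mem_singleton_mul.1 hx
  obtain ⟨a, ha, rfl⟩ := FractionalIdeal.mem_singleton_mul.1 hy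
  refine ⟨a, -b, by rw [← hxy]; ring, fun x hx => ⟨hint a ha x hx, ?_⟩⟩
  obtain ⟨y, hy⟩ := hint b hb x hx
  exact ⟨-y, by simp [hy]⟩

end Field

/-! ### Fractional linear transformations -/

section Action

variable {F : Type*} [Field F]

/-- The denominator `c z + d` of the action of `γ = (a, b; c, d)` through `σ`. -/
noncomputable def den (σ : F →+* ℝ) (γ : SL(2, F)) (z : ℂ) : ℂ :=
  (σ (γ 1 0) : ℂ) * z + (σ (γ 1 1) : ℂ)

/-- The numerator `a z + b` of the action of `γ = (a, b; c, d)` through `σ`. -/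
noncomputable def num (σ : F →+* ℝ) (γ : SL(2, F)) (z : ℂ) : ℂ :=
  (σ (γ 0 0) : ℂ) * z + (σ (γ 0 1) : ℂ)

lemma coe_map_smul (σ : F →+* ℝ) (γ : SL(2, F)) (z : ℍ) :
    ((Matrix.SpecialLinearGroup.map σ γ • z : ℍ) : ℂ) = num σ γ z / den σ γ z := by
  simpa [num, den] using
    UpperHalfPlane.coe_specialLinearGroup_apply (Matrix.SpecialLinearGroup.map σ γ) z

lemma map_det (σ : F →+* ℝ) (γ : SL(2, F)) :
    σ (γ 0 0) * σ (γ 1 1) - σ (γ 0 1) * σ (γ 1 0) = 1 := by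
  rw [← map_mul, ← map_mul, ← map_sub, ← Matrix.det_fin_two, γ.det_coe, map_one]

lemma den_ne_zero (σ : F →+* ℝ) (γ : SL(2, F)) {z : ℂ} (hz : 0 < z.im) : den σ γ z ≠ 0 := by
  intro h
  have h1 := congrArg im h
  have h2 := congrArg re h
  simp only [den, add_im, im_ofReal_mul, ofReal_im, add_zero, zero_im, mul_eq_zero, hz.ne',
    or_false] at h1
  simp only [den, h1, add_re, re_ofReal_mul, ofReal_re, zero_mul, zero_add, zero_re] at h2
  have := map_det σ γ
  rw [h1, h2] at this
  norm_num at this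

lemma im_num_div_den (σ : F →+* ℝ) (γ : SL(2, F)) (z : ℂ) :
    (num σ γ z / den σ γ z).im = z.im / normSq (den σ γ z) := by
  rw [div_im, div_sub_div_same]
  congr 1
  simp only [num, den, add_im, im_ofReal_mul, ofReal_im, add_zero, add_re, re_ofReal_mul, ofReal_re]
  linear_combination z.im * map_det σ γ

lemma im_num_div_den_pos (σ : F →+* ℝ) (γ : SL(2, F)) {z : ℂ} (hz : 0 < z.im) :
    0 < (num σ γ z / den σ γ z).im := by
  rw [im_num_div_den]
  exact div_pos hz (normSq_pos.2 (den_ne_zero σ γ hz))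

lemma den_mul (σ : F →+* ℝ) (γ g : SL(2, F)) {z : ℂ} (hz : 0 < z.im) :
    den σ (γ * g) z = den σ γ (num σ g z / den σ g z) * den σ g z := by
  have h := den_ne_zero σ g hz
  have e : den σ γ (num σ g z / den σ g z) * den σ g z =
      σ (γ 1 0) * num σ g z + σ (γ 1 1) * den σ g z := by
    rw [den, add_mul, mul_assoc, div_mul_cancel₀ _ h]
  rw [e]
  simp only [den, num, Matrix.SpecialLinearGroup.coe_mul, Matrix.mul_apply, Fin.sum_univ_two,
    map_add, map_mul]
  push_cast
  ring

lemma act_mul (σ₁ σ₂ : F →+* ℝ) (γ g : SL(2, F)) (z : ℍ × ℍ) :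
    act σ₁ σ₂ (γ * g) z = act σ₁ σ₂ γ (act σ₁ σ₂ g z) := by
  simp only [act, map_mul, mul_smul]

lemma act_one (σ₁ σ₂ : F →+* ℝ) (z : ℍ × ℍ) : act σ₁ σ₂ 1 z = z := by
  simp only [act, map_one, one_smul]

end Action

/-! ### Reduction theory -/

section Reduction

variable {F : Type*} [Field F] [NumberField F]

/-- Matrices in `SL₂(F)` whose top row lies in `I⁻¹` and bottom row in `I` are equivalent under
`SL₂(𝓞_F)`. -/
lemma inv_mul_mem_fullGroup {I : Ideal (𝓞 F)} {g h : SL(2, F)}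
    (hg : ∀ j, ∀ x ∈ I, ∃ y : 𝓞 F, (y : F) = g 0 j * x) (hg' : ∀ j, ∃ x ∈ I, (x : F) = g 1 j)
    (hh : ∀ j, ∀ x ∈ I, ∃ y : 𝓞 F, (y : F) = h 0 j * x) (hh' : ∀ j, ∃ x ∈ I, (x : F) = h 1 j) :
    g⁻¹ * h ∈ fullGroup F := by
  have key : ∀ i j, ∃ x : 𝓞 F, (x : F) = g 1 i * h 0 j - g 0 i * h 1 j := by
    intro i j
    obtain ⟨x, hx, hx'⟩ := hg' i
    obtain ⟨y, hy, hy'⟩ := hh' j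
    obtain ⟨u, hu⟩ := hh j x hx
    obtain ⟨v, hv⟩ := hg i y hy
    exact ⟨u - v, by simp only [map_sub, hu, hv, ← hx', ← hy']; ring⟩
  apply mem_fullGroup
  intro i j
  rw [Matrix.SpecialLinearGroup.coe_mul, Matrix.SpecialLinearGroup.coe_inv, Matrix.adjugate_fin_two]
  fin_cases i
  · obtain ⟨x, hx⟩ := key 1 j
    exact ⟨x, by rw [hx]; simp [Matrix.mul_apply, Fin.sum_univ_two]; ring⟩
  · obtain ⟨x, hx⟩ := key 0 j
    exact ⟨-x, by simp [hx, Matrix.mul_apply, Fin.sum_univ_two]; ring⟩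

/-- Pairs whose ideal lies in a given ideal class are, up to a scalar of norm bounded below, the
bottom rows of a single double coset. -/
lemma exists_matrix_of_class (hF : Module.finrank ℚ F = 2) {σ₁ σ₂ : F →+* ℝ} (hσ : σ₁ ≠ σ₂)
    (κ : ClassGroup (𝓞 F)) :
    ∃ (H : SL(2, F)) (M : ℝ), 0 < M ∧ ∀ (c d : 𝓞 F) (h : c ≠ 0 ∨ d ≠ 0),
      ClassGroup.mk0
        ⟨Ideal.span {c, d}, mem_nonZeroDivisors_iff_ne_zero.2 (span_pair_ne_bot h)⟩ = κ →
      ∃ γ ∈ fullGroup F, ∃ β : F, β * (H * γ) 1 0 = c ∧ β * (H * γ) 1 1 = d ∧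
        1 ≤ M * (|σ₁ β| * |σ₂ β|) := by
  by_cases hex : ∃ (c d : 𝓞 F) (h : c ≠ 0 ∨ d ≠ 0), ClassGroup.mk0
      ⟨Ideal.span {c, d}, mem_nonZeroDivisors_iff_ne_zero.2 (span_pair_ne_bot h)⟩ = κ
  swap
  · push Not at hex
    -- If no pair represents the class, the claim is vacuous and any values serve.
    exact ⟨1, 1, one_pos, fun c d h h' => absurd h' (hex c d h)⟩
  obtain ⟨c₀, d₀, h₀, hκ⟩ := hex
  obtain ⟨a₀, b₀, hab₀, hint₀⟩ := exists_bezout h₀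
  set I₀ : Ideal (𝓞 F) := Ideal.span {c₀, d₀} with hI₀
  have hM0 : 0 < Ideal.absNorm I₀ :=
    Nat.pos_of_ne_zero (by rw [Ne, Ideal.absNorm_eq_zero_iff]; exact span_pair_ne_bot h₀)
  refine ⟨⟨!![a₀, b₀; (c₀ : F), (d₀ : F)], by rw [Matrix.det_fin_two_of]; exact hab₀⟩,
    Ideal.absNorm I₀, by exact_mod_cast hM0, fun c d h hcd => ?_⟩
  rw [← hκ, ClassGroup.mk0_eq_mk0_iff] at hcd
  obtain ⟨x, y, hx, hy, hxy⟩ := hcd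
  change Ideal.span {x} * Ideal.span {c, d} = Ideal.span {y} * I₀ at hxy
  have hx' : (x : F) ≠ 0 := by simpa using hx
  have hy' : (y : F) ≠ 0 := by simpa using hy
  obtain ⟨a, b, hab, hint⟩ := exists_bezout h
  -- Since `x (c, d) = y I₀`, scaling by `x / y` carries the pair into `I₀`; scaling the top row by
  -- `y / x` keeps the determinant `1` and puts it in `I₀⁻¹`.
  have hex : ∀ e ∈ Ideal.span {c, d}, ∃ i ∈ I₀, (y : F) * i = x * e := by
    intro e he
    have h1 : x * e ∈ Ideal.span {y} * I₀ := hxy ▸ Ideal.mem_span_singleton_mul.2 ⟨e, he, rfl⟩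
    obtain ⟨i, hi, hi'⟩ := Ideal.mem_span_singleton_mul.1 h1
    exact ⟨i, hi, by rw [← map_mul, ← map_mul, hi']⟩
  obtain ⟨e, he, hec⟩ := hex c (Ideal.subset_span (by simp))
  obtain ⟨f, hf, hfd⟩ := hex d (Ideal.subset_span (by simp))
  have hint' : ∀ s : F, (∀ u ∈ Ideal.span {c, d}, ∃ v : 𝓞 F, (v : F) = s * u) →
      ∀ i ∈ I₀, ∃ v : 𝓞 F, (v : F) = s * (y / x) * i := by
    intro s hs i hi
    have h1 : y * i ∈ Ideal.span {x} * Ideal.span {c, d} :=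
      hxy ▸ Ideal.mem_span_singleton_mul.2 ⟨i, hi, rfl⟩
    obtain ⟨u, hu, hu'⟩ := Ideal.mem_span_singleton_mul.1 h1
    obtain ⟨v, hv⟩ := hs u hu
    refine ⟨v, ?_⟩
    have h2 : (x : F) * u = y * i := by rw [← map_mul, ← map_mul, hu']
    rw [hv]
    field_simp
    linear_combination s * h2
  have hdet : a * (y / x) * (f : F) - b * (y / x) * e = 1 := by
    field_simp
    linear_combination a * hfd - b * hec + (x : F) * hab
  set g : SL(2, F) := ⟨!![a * (y / x), b * (y / x); (e : F), (f : F)],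
    by rw [Matrix.det_fin_two_of]; exact hdet⟩ with hg
  set H : SL(2, F) := ⟨!![a₀, b₀; (c₀ : F), (d₀ : F)],
    by rw [Matrix.det_fin_two_of]; exact hab₀⟩ with hH
  refine ⟨H⁻¹ * g, inv_mul_mem_fullGroup (I := I₀) ?_ ?_ ?_ ?_, y / x, ?_, ?_, ?_⟩
  · intro j i hi
    fin_cases j
    · exact (hint₀ i hi).1
    · exact (hint₀ i hi).2
  · intro j
    fin_cases j
    · exact ⟨c₀, Ideal.subset_span (by simp), rfl⟩
    · exact ⟨d₀, Ideal.subset_span (by simp), rfl⟩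
  · intro j i hi
    fin_cases j
    · exact hint' a (fun u hu => (hint u hu).1) i hi
    · exact hint' b (fun u hu => (hint u hu).2) i hi
  · intro j
    fin_cases j
    · exact ⟨e, he, rfl⟩
    · exact ⟨f, hf, rfl⟩
  · rw [mul_inv_cancel_left]
    change (y : F) / x * e = c
    field_simp
    linear_combination hec
  · rw [mul_inv_cancel_left]
    change (y : F) / x * f = d
    field_simp
    linear_combination hfd
  -- Taking ideal norms, `N(I₀) |N(β)| = N((c, d)) ≥ 1`, which is why `M = N(I₀)`.
  · have hn : ∀ u : 𝓞 F, (Ideal.absNorm (Ideal.span {u}) : ℝ) =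
        |σ₁ (u : F)| * |σ₂ (u : F)| := by
      intro u
      rw [Ideal.absNorm_span_singleton, ← abs_mul, ← norm_eq_mul hF hσ, ← Algebra.coe_norm_int,
        Nat.cast_natAbs]
      push_cast
      rfl
    have h1 := congrArg (fun J => (Ideal.absNorm J : ℝ)) hxy
    simp only [map_mul, Nat.cast_mul] at h1
    rw [hn, hn] at h1
    have h2 : (1 : ℝ) ≤ Ideal.absNorm (Ideal.span {c, d}) := by
      have : Ideal.absNorm (Ideal.span {c, d}) ≠ 0 := by
        rw [Ne, Ideal.absNorm_eq_zero_iff]; exact span_pair_ne_bot h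
      exact_mod_cast Nat.one_le_iff_ne_zero.2 this
    have hX : 0 < |σ₁ (x : F)| * |σ₂ (x : F)| :=
      mul_pos (abs_pos.2 ((map_ne_zero _).2 hx')) (abs_pos.2 ((map_ne_zero _).2 hx'))
    have h3 : (Ideal.absNorm I₀ : ℝ) * (|σ₁ (y / x : F)| * |σ₂ (y / x : F)|) =
        Ideal.absNorm (Ideal.span {c, d}) := by
      rw [map_div₀, map_div₀, abs_div, abs_div, div_mul_div_comm, ← mul_div_assoc,
        div_eq_iff hX.ne']
      linear_combination -h1
    rw [h3]
    exact h2

/-- Reduction theory: finitely many translates of `{y₁ y₂ ≥ c}` cover `ℍ × ℍ` modulo `Γ`. -/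
lemma exists_reduction (hF : Module.finrank ℚ F = 2) {σ₁ σ₂ : F →+* ℝ} (hσ : σ₁ ≠ σ₂)
    {Γ : Subgroup SL(2, F)} (hΓ : Γ.relIndex (fullGroup F) ≠ 0) :
    ∃ (A : Set SL(2, F)) (c : ℝ), A.Finite ∧ 0 < c ∧ ∀ z : ℍ × ℍ, ∃ γ ∈ Γ, ∃ g ∈ A, ∃ w : ℍ × ℍ,
      z = act σ₁ σ₂ γ (act σ₁ σ₂ g w) ∧ c ≤ w.1.im * w.2.im := by
  choose H M hM0 hM using exists_matrix_of_class hF hσ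
  obtain ⟨M', hM'⟩ := Finite.exists_le M
  have hM'0 : 0 < M' := (hM0 1).trans_le (hM' 1)
  obtain ⟨C, hC0, hC⟩ := exists_small_pair hσ
  have : (Γ.subgroupOf (fullGroup F)).FiniteIndex := ⟨hΓ⟩
  have hfin : Finite (fullGroup F ⧸ Γ.subgroupOf (fullGroup F)) :=
    Subgroup.finite_quotient_of_finiteIndex
  set r : fullGroup F ⧸ Γ.subgroupOf (fullGroup F) → SL(2, F) := fun q => (q.out : SL(2, F)) with hr
  refine ⟨range fun p : (fullGroup F ⧸ Γ.subgroupOf (fullGroup F)) × ClassGroup (𝓞 F) =>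
    (r p.1)⁻¹ * (H p.2)⁻¹, 1 / (C * M') ^ 2, finite_range _, by positivity, fun z => ?_⟩
  obtain ⟨c, d, hcd, h1, h2⟩ := hC z.1 z.2 z.1.im_pos z.2.im_pos
  obtain ⟨γ, hγ, β, hβc, hβd, hβ⟩ := hM _ c d hcd rfl
  set κ := ClassGroup.mk0 ⟨Ideal.span {c, d},
    mem_nonZeroDivisors_iff_ne_zero.2 (span_pair_ne_bot hcd)⟩ with hκ
  set q : fullGroup F ⧸ Γ.subgroupOf (fullGroup F) := QuotientGroup.mk ⟨γ, hγ⟩ with hq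
  have hmem : (r q)⁻¹ * γ ∈ Γ := by
    have : q.out⁻¹ * ⟨γ, hγ⟩ ∈ Γ.subgroupOf (fullGroup F) := by
      rw [← QuotientGroup.eq, QuotientGroup.out_eq']
    exact this
  refine ⟨((r q)⁻¹ * γ)⁻¹, inv_mem hmem, (r q)⁻¹ * (H κ)⁻¹, ⟨(q, κ), rfl⟩,
    act σ₁ σ₂ (H κ * γ) z, ?_, ?_⟩
  · rw [← act_mul, ← act_mul]
    have : ((r q)⁻¹ * γ)⁻¹ * ((r q)⁻¹ * (H κ)⁻¹) * (H κ * γ) = 1 := by group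
    rw [this, act_one]
  -- The bottom row of `H γ` is `(c, d) / β`, so smallness of `c z + d` makes the new height large;
  -- the product of heights is then controlled by the norm of `β`.
  · have key : ∀ (σ : F →+* ℝ) (z : ℍ), normSq ((σ (c : F) : ℂ) * z + (σ (d : F) : ℂ)) ≤ C * z.im →
        |σ β| ^ 2 / C ≤ (Matrix.SpecialLinearGroup.map σ (H κ * γ) • z).im := by
      intro σ z h
      have e : (σ (c : F) : ℂ) * z + (σ (d : F) : ℂ) = (σ β : ℂ) * den σ (H κ * γ) z := by
        rw [← hβc, ← hβd, den, map_mul, map_mul]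
        push_cast
        ring
      rw [e, normSq_mul, normSq_ofReal] at h
      have hd := normSq_pos.2 (den_ne_zero σ (H κ * γ) z.im_pos)
      rw [← UpperHalfPlane.coe_im, coe_map_smul, im_num_div_den, sq_abs, div_le_div_iff₀ hC0 hd,
        pow_two, mul_comm _ C]
      exact h
    have k1 := key σ₁ z.1 h1
    have k2 := key σ₂ z.2 h2
    calc 1 / (C * M') ^ 2 ≤ (|σ₁ β| ^ 2 / C) * (|σ₂ β| ^ 2 / C) := by
          rw [div_mul_div_comm, div_le_div_iff₀ (by positivity) (by positivity)]
          have h3 : 1 ≤ M' * (|σ₁ β| * |σ₂ β|) :=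
            hβ.trans (mul_le_mul_of_nonneg_right (hM' κ) (by positivity))
          have h4 : 1 ≤ (M' * (|σ₁ β| * |σ₂ β|)) ^ 2 := one_le_pow₀ h3
          nlinarith [mul_pos hC0 hC0]
      _ ≤ _ := mul_le_mul k1 k2 (by positivity) (UpperHalfPlane.im_pos _).le

end Reduction

/-! ### Unipotent and hyperbolic elements at each cusp -/

section Cusps

variable {F : Type*} [Field F]

/-- The unipotent matrix `(1, x; 0, 1)`. -/
def unip (x : F) : SL(2, F) := ⟨!![1, x; 0, 1], by simp [Matrix.det_fin_two_of]⟩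

/-- The diagonal matrix `(u, 0; 0, u⁻¹)`. -/
def diag (u : Fˣ) : SL(2, F) := ⟨!![(u : F), 0; 0, ((u⁻¹ : Fˣ) : F)], by
  rw [Matrix.det_fin_two_of, Units.mul_inv]; simp⟩

lemma unip_pow (x : F) (n : ℕ) : unip x ^ n = unip (n * x) := by
  induction n with
  | zero =>
    ext i j
    rw [pow_zero, Matrix.SpecialLinearGroup.coe_one]
    fin_cases i <;> fin_cases j <;> simp [unip]
  | succ n ih =>
    rw [pow_succ, ih]
    ext i j
    rw [Matrix.SpecialLinearGroup.coe_mul]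
    fin_cases i <;> fin_cases j <;> simp [unip, Matrix.mul_apply, Fin.sum_univ_two]
    ring

lemma diag_pow (u : Fˣ) (n : ℕ) : diag u ^ n = diag (u ^ n) := by
  induction n with
  | zero =>
    ext i j
    rw [pow_zero, Matrix.SpecialLinearGroup.coe_one]
    fin_cases i <;> fin_cases j <;> simp [diag]
  | succ n ih =>
    rw [pow_succ, ih]
    ext i j
    rw [Matrix.SpecialLinearGroup.coe_mul]
    fin_cases i <;> fin_cases j <;> simp [diag, Matrix.mul_apply, Fin.sum_univ_two, pow_succ]
    rw [mul_comm]

variable [NumberField F]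

lemma exists_denominator (g : SL(2, F)) :
    ∃ n : ℤ, n ≠ 0 ∧ ∀ i j, ∃ y : 𝓞 F, (y : F) = n * g i j := by
  classical
  obtain ⟨n, hn, h⟩ := exists_integral_multiples ℤ ℚ
    (Finset.univ.image fun p : Fin 2 × Fin 2 => g p.1 p.2)
  refine ⟨n, hn, fun i j => ?_⟩
  have h1 := h (g i j) (Finset.mem_image.2 ⟨(i, j), Finset.mem_univ _, rfl⟩)
  rw [zsmul_eq_mul] at h1
  exact ⟨⟨_, h1⟩, rfl⟩

/-- The entries of `g (unip x) g⁻¹ - 1` are, up to sign, `x` times products of two entries of `g`,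
so `n²` clears the denominators. -/
lemma conj_unip_mem_fullGroup {g : SL(2, F)} {n : ℤ}
    (h : ∀ i j, ∃ y : 𝓞 F, (y : F) = n * g i j) (b : 𝓞 F) :
    g * unip ((n : F) ^ 2 * b) * g⁻¹ ∈ fullGroup F := by
  choose y hy using h
  have hd := g.det_coe
  rw [Matrix.det_fin_two] at hd
  apply mem_fullGroup
  intro i j
  rw [Matrix.SpecialLinearGroup.coe_mul, Matrix.SpecialLinearGroup.coe_mul,
    Matrix.SpecialLinearGroup.coe_inv, Matrix.adjugate_fin_two]
  fin_cases i <;> fin_cases j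
  · refine ⟨1 - b * (y 0 0 * y 1 0), ?_⟩
    simp [unip, hy, Matrix.mul_apply, Fin.sum_univ_two]
    linear_combination -hd
  · refine ⟨b * y 0 0 ^ 2, ?_⟩
    simp [unip, hy, Matrix.mul_apply, Fin.sum_univ_two]
    ring
  · refine ⟨-(b * y 1 0 ^ 2), ?_⟩
    simp [unip, hy, Matrix.mul_apply, Fin.sum_univ_two]
    ring
  · refine ⟨1 + b * (y 0 0 * y 1 0), ?_⟩
    simp [unip, hy, Matrix.mul_apply, Fin.sum_univ_two]
    linear_combination -hd

/-- The deviation from the identity involves only `u - 1` and `u⁻¹ - 1` times products of two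
entries of `g`; congruence to `1` modulo `n²` clears the denominators. -/
lemma conj_diag_mem_fullGroup {g : SL(2, F)} {n : ℤ}
    (h : ∀ i j, ∃ y : 𝓞 F, (y : F) = n * g i j) {u : Fˣ} {e e' : 𝓞 F}
    (he : (u : F) = 1 + (n : F) ^ 2 * e) (he' : ((u⁻¹ : Fˣ) : F) = 1 + (n : F) ^ 2 * e') :
    g * diag u * g⁻¹ ∈ fullGroup F := by
  choose y hy using h
  have hd := g.det_coe
  rw [Matrix.det_fin_two] at hd
  apply mem_fullGroup
  intro i j
  rw [Matrix.SpecialLinearGroup.coe_mul, Matrix.SpecialLinearGroup.coe_mul,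
    Matrix.SpecialLinearGroup.coe_inv, Matrix.adjugate_fin_two]
  fin_cases i <;> fin_cases j
  · refine ⟨1 + y 0 0 * y 1 1 * e - y 0 1 * y 1 0 * e', ?_⟩
    simp [diag, hy, Matrix.mul_apply, Fin.sum_univ_two, -Units.val_inv_eq_inv_val, he, he']
    linear_combination -hd
  · refine ⟨-(y 0 0 * y 0 1 * (e - e')), ?_⟩
    simp [diag, hy, Matrix.mul_apply, Fin.sum_univ_two, -Units.val_inv_eq_inv_val, he, he']
    ring
  · refine ⟨y 1 0 * y 1 1 * (e - e'), ?_⟩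
    simp [diag, hy, Matrix.mul_apply, Fin.sum_univ_two, -Units.val_inv_eq_inv_val, he, he']
    ring
  · refine ⟨1 - y 0 1 * y 1 0 * e + y 0 0 * y 1 1 * e', ?_⟩
    simp [diag, hy, Matrix.mul_apply, Fin.sum_univ_two, -Units.val_inv_eq_inv_val, he, he']
    linear_combination -hd

lemma exists_pow_congr_one (u : (𝓞 F)ˣ) {n : ℤ} (hn : n ≠ 0) :
    ∃ m : ℕ, 0 < m ∧ ∃ e e' : 𝓞 F, ((u ^ m : (𝓞 F)ˣ) : 𝓞 F) = 1 + (n : 𝓞 F) ^ 2 * e ∧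
      (((u ^ m)⁻¹ : (𝓞 F)ˣ) : 𝓞 F) = 1 + (n : 𝓞 F) ^ 2 * e' := by
  set I : Ideal (𝓞 F) := Ideal.span {(n : 𝓞 F) ^ 2} with hI
  have hI0 : I ≠ ⊥ := by
    rw [hI, Ne, Ideal.span_singleton_eq_bot]
    exact pow_ne_zero _ (by exact_mod_cast hn)
  have : Finite (𝓞 F ⧸ I) := Ring.HasFiniteQuotients.finiteQuotient hI0
  set v : (𝓞 F ⧸ I)ˣ := Units.map (Ideal.Quotient.mk I : 𝓞 F →* 𝓞 F ⧸ I) u with hv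
  refine ⟨orderOf v, (isOfFinOrder_of_finite v).orderOf_pos, ?_⟩
  have key : ∀ w : (𝓞 F)ˣ, Units.map (Ideal.Quotient.mk I : 𝓞 F →* 𝓞 F ⧸ I) w = 1 →
      ∃ e : 𝓞 F, (w : 𝓞 F) = 1 + (n : 𝓞 F) ^ 2 * e := by
    intro w hw
    have h1 : Ideal.Quotient.mk I (w : 𝓞 F) = Ideal.Quotient.mk I 1 := by
      have := congrArg Units.val hw
      simpa using this
    rw [Ideal.Quotient.eq, hI, Ideal.mem_span_singleton] at h1
    obtain ⟨e, he⟩ := h1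
    exact ⟨e, by rw [← he]; ring⟩
  have h1 : Units.map (Ideal.Quotient.mk I : 𝓞 F →* 𝓞 F ⧸ I) (u ^ orderOf v) = 1 := by
    rw [map_pow, ← hv, pow_orderOf_eq_one]
  obtain ⟨e, he⟩ := key _ h1
  obtain ⟨e', he'⟩ := key (u ^ orderOf v)⁻¹ (by rw [map_inv, h1, inv_one])
  exact ⟨e, e', he, he'⟩

lemma conj_pow {G : Type*} [Group G] (g x : G) (n : ℕ) : (g * x * g⁻¹) ^ n = g * x ^ n * g⁻¹ := by
  induction n with
  | zero => simp
  | succ n ih => rw [pow_succ, ih, pow_succ]; group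

lemma exists_conj_unip_mem {Γ : Subgroup SL(2, F)} (hΓ : Γ.relIndex (fullGroup F) ≠ 0)
    (g : SL(2, F)) (b : 𝓞 F) :
    ∃ N : ℕ, 0 < N ∧ g * unip ((N : F) * b) * g⁻¹ ∈ Γ := by
  obtain ⟨n, hn, h⟩ := exists_denominator g
  obtain ⟨m, hm, -, hm'⟩ := Subgroup.exists_pow_mem_of_relIndex_ne_zero hΓ
    (conj_unip_mem_fullGroup h b)
  rw [conj_pow, unip_pow] at hm'
  refine ⟨m * n.natAbs ^ 2, by positivity, ?_⟩
  have e : ((m * n.natAbs ^ 2 : ℕ) : F) * b = m * ((n : F) ^ 2 * b) := by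
    have : ((n.natAbs ^ 2 : ℕ) : F) = (n : F) ^ 2 := by
      rw [Nat.cast_pow, Nat.cast_natAbs, ← Int.cast_pow, sq_abs, Int.cast_pow]
    rw [Nat.cast_mul, this]
    ring
  rw [e]
  exact hm'.1

/-- One power of a large unit achieves the congruence modulo `n²`, a further power enters `Γ` by
finite index; both keep absolute norm one and size above one at `σ₁`. -/
lemma exists_conj_diag_mem (hF : Module.finrank ℚ F = 2) {σ₁ σ₂ : F →+* ℝ} (hσ : σ₁ ≠ σ₂)
    {Γ : Subgroup SL(2, F)} (hΓ : Γ.relIndex (fullGroup F) ≠ 0) (g : SL(2, F)) :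
    ∃ u : Fˣ, g * diag u * g⁻¹ ∈ Γ ∧ 1 < |σ₁ u| ∧ |σ₁ u| * |σ₂ u| = 1 := by
  obtain ⟨n, hn, h⟩ := exists_denominator g
  obtain ⟨u, hu⟩ := exists_unit_one_lt hF hσ
  obtain ⟨m, hm, e, e', he, he'⟩ := exists_pow_congr_one u hn
  set v : Fˣ := Units.map (algebraMap (𝓞 F) F : 𝓞 F →* F) (u ^ m) with hv
  obtain ⟨l, hl, -, hl'⟩ := Subgroup.exists_pow_mem_of_relIndex_ne_zero hΓ
    (conj_diag_mem_fullGroup (u := v) h (e := e) (e' := e')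
      (by
        have := congrArg (algebraMap (𝓞 F) F) he
        simpa [hv] using this)
      (by
        have := congrArg (algebraMap (𝓞 F) F) he'
        rw [hv, ← map_inv]
        simpa only [Units.coe_map, MonoidHom.coe_coe, map_add, map_mul, map_pow, map_one,
          map_intCast] using this))
  rw [conj_pow, diag_pow] at hl'
  have hval : ((v ^ l : Fˣ) : F) = ((u ^ (m * l) : (𝓞 F)ˣ) : F) := by
    simp [hv, pow_mul]
  refine ⟨v ^ l, hl'.1, ?_, ?_⟩
  · rw [hval]
    have : σ₁ ((u ^ (m * l) : (𝓞 F)ˣ) : F) = σ₁ (u : F) ^ (m * l) := by simp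
    rw [this, abs_pow]
    exact one_lt_pow₀ hu (by positivity)
  · rw [hval]
    exact abs_mul_units hF hσ _

end Cusps

/-! ### Forms, the slash operator and invariance at cusps -/

section Forms

variable {F : Type*} [Field F]

/-- The fractional linear transformation of `γ` through `σ`. -/
noncomputable def moebius (σ : F →+* ℝ) (γ : SL(2, F)) (z : ℂ) : ℂ := num σ γ z / den σ γ z

lemma moebius_im_pos (σ : F →+* ℝ) (γ : SL(2, F)) {z : ℂ} (hz : 0 < z.im) :
    0 < (moebius σ γ z).im := im_num_div_den_pos σ γ hz

lemma moebius_mul (σ : F →+* ℝ) (γ g : SL(2, F)) {z : ℂ} (hz : 0 < z.im) :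
    moebius σ (γ * g) z = moebius σ γ (moebius σ g z) := by
  have h := den_ne_zero σ g hz
  have h' := den_ne_zero σ γ (moebius_im_pos σ g hz)
  have e : num σ (γ * g) z = num σ γ (moebius σ g z) * den σ g z := by
    have : num σ γ (moebius σ g z) * den σ g z =
        σ (γ 0 0) * num σ g z + σ (γ 0 1) * den σ g z := by
      rw [num, add_mul, mul_assoc, moebius, div_mul_cancel₀ _ h]
    rw [this]
    simp only [den, num, Matrix.SpecialLinearGroup.coe_mul, Matrix.mul_apply, Fin.sum_univ_two,
      map_add, map_mul]
    push_cast
    ring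
  rw [moebius, e, den_mul σ γ g hz, mul_div_mul_right _ _ h]
  rfl

lemma differentiableOn_moebius (σ : F →+* ℝ) (γ : SL(2, F)) :
    DifferentiableOn ℂ (moebius σ γ) {z | 0 < z.im} := by
  unfold moebius
  refine DifferentiableOn.div ?_ ?_ fun z hz => den_ne_zero σ γ hz
  · unfold num; fun_prop
  · unfold den; fun_prop

lemma hasDerivAt_moebius (σ : F →+* ℝ) (γ : SL(2, F)) {z : ℂ} (hz : 0 < z.im) :
    HasDerivAt (moebius σ γ) (den σ γ z ^ (-2 : ℤ)) z := by
  have h := den_ne_zero σ γ hz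
  have h1 : HasDerivAt (num σ γ) (σ (γ 0 0) : ℂ) z := by
    unfold num
    simpa using ((hasDerivAt_id z).const_mul (σ (γ 0 0) : ℂ)).add_const (σ (γ 0 1) : ℂ)
  have h2 : HasDerivAt (den σ γ) (σ (γ 1 0) : ℂ) z := by
    unfold den
    simpa using ((hasDerivAt_id z).const_mul (σ (γ 1 0) : ℂ)).add_const (σ (γ 1 1) : ℂ)
  refine (h1.div h2 h).congr_deriv ?_
  rw [zpow_neg, div_eq_iff (pow_ne_zero 2 h)]
  have e : den σ γ z ^ (2 : ℤ) = den σ γ z ^ 2 := by norm_cast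
  rw [e, inv_mul_cancel₀ (pow_ne_zero 2 h)]
  have hd : (σ (γ 0 0) : ℂ) * σ (γ 1 1) - σ (γ 0 1) * σ (γ 1 0) = 1 := by
    exact_mod_cast map_det σ γ
  unfold num den
  linear_combination hd

/-- Modular forms of weight `(k₁, k₂)` as curvewise holomorphic functions of two variables. -/
structure IsCurveForm (σ₁ σ₂ : F →+* ℝ) (Γ : Subgroup SL(2, F)) (k₁ k₂ : ℤ) (G : ℂ → ℂ → ℂ) :
    Prop where
  holo : CurveHolomorphic G
  transform : ∀ γ ∈ Γ, ∀ z w : ℂ, 0 < z.im → 0 < w.im →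
    G (moebius σ₁ γ z) (moebius σ₂ γ w) = den σ₁ γ z ^ k₁ * den σ₂ γ w ^ k₂ * G z w

/-- The slash operator. -/
noncomputable def slash (σ₁ σ₂ : F →+* ℝ) (k₁ k₂ : ℤ) (g : SL(2, F)) (G : ℂ → ℂ → ℂ)
    (z w : ℂ) : ℂ :=
  (den σ₁ g z ^ k₁ * den σ₂ g w ^ k₂)⁻¹ * G (moebius σ₁ g z) (moebius σ₂ g w)

variable {σ₁ σ₂ : F →+* ℝ} {Γ : Subgroup SL(2, F)} {k₁ k₂ : ℤ} {G : ℂ → ℂ → ℂ}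

lemma CurveHolomorphic.swap (hG : CurveHolomorphic G) : CurveHolomorphic fun z w => G w z where
  continuousOn := hG.continuousOn.comp (f := Prod.swap) continuous_swap.continuousOn
    fun _ hp => ⟨hp.2, hp.1⟩
  differentiableOn V α β hV hα hβ h :=
    hG.differentiableOn V β α hV hβ hα fun t ht => ⟨(h t ht).2, (h t ht).1⟩

lemma IsCurveForm.swap (hG : IsCurveForm σ₁ σ₂ Γ k₁ k₂ G) :
    IsCurveForm σ₂ σ₁ Γ k₂ k₁ fun z w => G w z where
  holo := hG.holo.swap
  transform γ hγ z w hz hw := by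
    rw [hG.transform γ hγ w z hw hz]
    ring

lemma continuousOn_moebius_prod (σ₁ σ₂ : F →+* ℝ) (g : SL(2, F)) :
    ContinuousOn (fun p : ℂ × ℂ => (moebius σ₁ g p.1, moebius σ₂ g p.2))
      {p | 0 < p.1.im ∧ 0 < p.2.im} :=
  ((differentiableOn_moebius σ₁ g).continuousOn.comp continuousOn_fst fun _ hp => hp.1).prodMk
    ((differentiableOn_moebius σ₂ g).continuousOn.comp continuousOn_snd fun _ hp => hp.2)

lemma CurveHolomorphic.slash (hG : CurveHolomorphic G) (g : SL(2, F)) :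
    CurveHolomorphic (slash σ₁ σ₂ k₁ k₂ g G) := by
  have hne : ∀ (σ : F →+* ℝ) (k : ℤ) (z : ℂ), 0 < z.im → den σ g z ^ k ≠ 0 := fun σ k z hz =>
    zpow_ne_zero _ (den_ne_zero σ g hz)
  have hden : ∀ (σ : F →+* ℝ), Differentiable ℂ (den σ g) := fun σ => by unfold den; fun_prop
  constructor
  · unfold HilbertModular.slash
    refine ContinuousOn.mul (ContinuousOn.inv₀ (ContinuousOn.mul ?_ ?_) ?_) ?_
    · exact ((hden σ₁).continuous.comp continuous_fst).continuousOn.zpow₀ _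
        fun p hp => Or.inl (den_ne_zero σ₁ g hp.1)
    · exact ((hden σ₂).continuous.comp continuous_snd).continuousOn.zpow₀ _
        fun p hp => Or.inl (den_ne_zero σ₂ g hp.2)
    · exact fun p hp => mul_ne_zero (hne _ _ _ hp.1) (hne _ _ _ hp.2)
    · exact hG.continuousOn.comp (continuousOn_moebius_prod σ₁ σ₂ g)
        fun p hp => ⟨moebius_im_pos _ _ hp.1, moebius_im_pos _ _ hp.2⟩
  · intro V α β hV hα hβ h
    unfold HilbertModular.slash
    refine DifferentiableOn.mul (DifferentiableOn.inv (DifferentiableOn.mul ?_ ?_) ?_) ?_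
    · exact ((hden σ₁).comp_differentiableOn hα).zpow
        (Or.inl fun t ht => den_ne_zero σ₁ g (h t ht).1)
    · exact ((hden σ₂).comp_differentiableOn hβ).zpow
        (Or.inl fun t ht => den_ne_zero σ₂ g (h t ht).2)
    · exact fun t ht => mul_ne_zero (hne _ _ _ (h t ht).1) (hne _ _ _ (h t ht).2)
    · exact hG.differentiableOn V _ _ hV
        ((differentiableOn_moebius σ₁ g).comp hα fun t ht => (h t ht).1)
        ((differentiableOn_moebius σ₂ g).comp hβ fun t ht => (h t ht).2)
        fun t ht => ⟨moebius_im_pos _ _ (h t ht).1, moebius_im_pos _ _ (h t ht).2⟩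

lemma sqrt_moebius_im (σ : F →+* ℝ) (g : SL(2, F)) (z : ℂ) :
    √(moebius σ g z).im = √z.im / ‖den σ g z‖ := by
  rw [moebius, im_num_div_den, Real.sqrt_div' _ (normSq_nonneg _), normSq_eq_norm_sq,
    Real.sqrt_sq (norm_nonneg _)]

/-- The factor `|c z + d|` in `√Im(g z)` cancels the automorphy factor, so estimates at the cusp of
`g` transfer to `G` itself. -/
lemma petersson_slash (g : SL(2, F)) {z w : ℂ} :
    petersson k₁ k₂ (slash σ₁ σ₂ k₁ k₂ g G) z w =
      petersson k₁ k₂ G (moebius σ₁ g z) (moebius σ₂ g w) := by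
  unfold petersson slash
  rw [sqrt_moebius_im, sqrt_moebius_im, norm_mul, norm_inv, norm_mul, norm_zpow, norm_zpow,
    div_zpow, div_zpow, mul_inv]
  ring

lemma IsCurveForm.petersson_moebius (hG : IsCurveForm σ₁ σ₂ Γ k₁ k₂ G) {γ : SL(2, F)} (hγ : γ ∈ Γ)
    {z w : ℂ} (hz : 0 < z.im) (hw : 0 < w.im) :
    petersson k₁ k₂ G (moebius σ₁ γ z) (moebius σ₂ γ w) = petersson k₁ k₂ G z w := by
  rw [← petersson_slash]
  have : slash σ₁ σ₂ k₁ k₂ γ G z w = G z w := by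
    rw [slash, hG.transform γ hγ z w hz hw, inv_mul_cancel_left₀]
    exact mul_ne_zero (zpow_ne_zero _ (den_ne_zero _ _ hz)) (zpow_ne_zero _ (den_ne_zero _ _ hw))
  rw [petersson, petersson, this]

lemma IsCurveForm.petersson_slash_moebius (hG : IsCurveForm σ₁ σ₂ Γ k₁ k₂ G) {g u : SL(2, F)}
    (hu : g * u * g⁻¹ ∈ Γ) {z w : ℂ} (hz : 0 < z.im) (hw : 0 < w.im) :
    petersson k₁ k₂ (slash σ₁ σ₂ k₁ k₂ g G) (moebius σ₁ u z) (moebius σ₂ u w) =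
      petersson k₁ k₂ (slash σ₁ σ₂ k₁ k₂ g G) z w := by
  have e : ∀ (σ : F →+* ℝ) (z : ℂ), 0 < z.im →
      moebius σ g (moebius σ u z) = moebius σ (g * u * g⁻¹) (moebius σ g z) := by
    intro σ z hz
    rw [← moebius_mul σ _ _ hz, ← moebius_mul σ _ _ hz, inv_mul_cancel_right]
  rw [petersson_slash, petersson_slash, e _ _ hz, e _ _ hw,
    hG.petersson_moebius hu (moebius_im_pos _ _ hz) (moebius_im_pos _ _ hw)]

lemma den_unip (σ : F →+* ℝ) (x : F) (z : ℂ) : den σ (unip x) z = 1 := by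
  simp [den, unip]

lemma moebius_unip (σ : F →+* ℝ) (x : F) (z : ℂ) : moebius σ (unip x) z = z + σ x := by
  rw [moebius, den_unip]
  simp [num, unip]

lemma moebius_diag (σ : F →+* ℝ) (u : Fˣ) (z : ℂ) :
    moebius σ (diag u) z = ((σ u) ^ 2 : ℝ) * z := by
  have h : σ u ≠ 0 := (map_ne_zero σ).2 u.ne_zero
  have h' : (σ u : ℂ) ≠ 0 := by exact_mod_cast h
  simp [moebius, num, den, diag]
  ring

lemma IsCurveForm.slash_add (hG : IsCurveForm σ₁ σ₂ Γ k₁ k₂ G) {g : SL(2, F)} {x : F}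
    (hx : g * unip x * g⁻¹ ∈ Γ) {z w : ℂ} (hz : 0 < z.im) (hw : 0 < w.im) :
    slash σ₁ σ₂ k₁ k₂ g G (z + σ₁ x) (w + σ₂ x) = slash σ₁ σ₂ k₁ k₂ g G z w := by
  set γ := g * unip x * g⁻¹ with hγ
  have e : ∀ (σ : F →+* ℝ) (z : ℂ), 0 < z.im →
      moebius σ g (moebius σ (unip x) z) = moebius σ γ (moebius σ g z) := by
    intro σ z hz
    rw [← moebius_mul σ _ _ hz, ← moebius_mul σ _ _ hz, hγ, inv_mul_cancel_right]
  have d : ∀ (σ : F →+* ℝ) (z : ℂ), 0 < z.im →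
      den σ g (moebius σ (unip x) z) = den σ γ (moebius σ g z) * den σ g z := by
    intro σ z hz
    have h1 : den σ (g * unip x) z = den σ g (moebius σ (unip x) z) * den σ (unip x) z :=
      den_mul σ g (unip x) hz
    have h2 := den_mul σ γ g hz
    rw [den_unip, mul_one] at h1
    rw [hγ, inv_mul_cancel_right, ← hγ] at h2
    exact h1.symm.trans h2
  rw [← moebius_unip, ← moebius_unip]
  have hz' := moebius_im_pos σ₁ g hz
  have hw' := moebius_im_pos σ₂ g hw
  rw [slash, d _ _ hz, d _ _ hw, e _ _ hz, e _ _ hw, hG.transform γ hx _ _ hz' hw', slash,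
    mul_zpow, mul_zpow]
  have n1 := zpow_ne_zero k₁ (den_ne_zero σ₁ γ hz')
  have n2 := zpow_ne_zero k₂ (den_ne_zero σ₂ γ hw')
  have n3 := zpow_ne_zero k₁ (den_ne_zero σ₁ g hz)
  have n4 := zpow_ne_zero k₂ (den_ne_zero σ₂ g hw)
  field_simp

lemma IsCurveForm.cuspInvariant [NumberField F] (hG : IsCurveForm σ₁ σ₂ Γ k₁ k₂ G)
    (hF : Module.finrank ℚ F = 2) (hσ : σ₁ ≠ σ₂) (hΓ : Γ.relIndex (fullGroup F) ≠ 0)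
    (g : SL(2, F)) : ∃ N a b δ : ℝ, CuspInvariant k₁ k₂ (slash σ₁ σ₂ k₁ k₂ g G) N a b δ := by
  obtain ⟨θ, hθ⟩ := exists_integer_ne hσ
  obtain ⟨N, hN, hN'⟩ := exists_conj_unip_mem hΓ g 1
  obtain ⟨M, hM, hM'⟩ := exists_conj_unip_mem hΓ g θ
  obtain ⟨u, hu, hu1, hu2⟩ := exists_conj_diag_mem hF hσ hΓ g
  have hM0 : (M : ℝ) ≠ 0 := by exact_mod_cast hM.ne'
  -- Translations by multiples of `1` and `θ` span a lattice because `θ` has distinct conjugates;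
  -- `diag u` scales by `σ₁(u)²` and `σ₂(u)²`, which are mutually inverse.
  refine ⟨N, σ₁ (M * θ), σ₂ (M * θ), σ₁ u ^ 2, hG.holo.slash g, by exact_mod_cast hN, ?_, ?_,
    fun z w hz hw => ?_, fun z w hz hw => hG.slash_add hM' hz hw, fun z w hz hw => ?_⟩
  · simpa [hM0] using hθ
  · rw [← sq_abs]
    exact one_lt_pow₀ hu1 two_ne_zero
  · have := hG.slash_add hN' hz hw
    simpa using this
  · have e : (σ₁ u ^ 2)⁻¹ = σ₂ u ^ 2 := by
      rw [← sq_abs, ← sq_abs (σ₂ u), inv_eq_iff_eq_inv]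
      refine eq_inv_of_mul_eq_one_left ?_
      rw [← mul_pow, hu2, one_pow]
    rw [e, ← moebius_diag, ← moebius_diag]
    exact hG.petersson_slash_moebius hu hz hw

end Forms

/-! ### Vanishing and constancy -/

variable {F : Type*} [Field F] {σ₁ σ₂ : F →+* ℝ} {Γ : Subgroup SL(2, F)} {k₁ k₂ : ℤ}
  {G : ℂ → ℂ → ℂ}

lemma CurveHolomorphic.continuousOn_petersson (hG : CurveHolomorphic G) :
    ContinuousOn (fun p : ℂ × ℂ => petersson k₁ k₂ G p.1 p.2) {p | 0 < p.1.im ∧ 0 < p.2.im} := by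
  unfold petersson
  refine (hG.continuousOn.norm.mul ?_).mul ?_
  · exact (Real.continuous_sqrt.comp (continuous_im.comp continuous_fst)).continuousOn.zpow₀ _
      fun p hp => Or.inl (Real.sqrt_pos.2 hp.1).ne'
  · exact (Real.continuous_sqrt.comp (continuous_im.comp continuous_snd)).continuousOn.zpow₀ _
      fun p hp => Or.inl (Real.sqrt_pos.2 hp.2).ne'

lemma exists_reduction_moebius [NumberField F] (hF : Module.finrank ℚ F = 2) (hσ : σ₁ ≠ σ₂)
    (hΓ : Γ.relIndex (fullGroup F) ≠ 0) :
    ∃ (A : Set SL(2, F)) (c : ℝ), A.Finite ∧ 0 < c ∧ ∀ z w : ℂ, 0 < z.im → 0 < w.im →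
      ∃ γ ∈ Γ, ∃ g ∈ A, ∃ z' w' : ℂ, 0 < z'.im ∧ 0 < w'.im ∧ c ≤ z'.im * w'.im ∧
        z = moebius σ₁ γ (moebius σ₁ g z') ∧ w = moebius σ₂ γ (moebius σ₂ g w') := by
  obtain ⟨A, c, hA, hc, h⟩ := exists_reduction hF hσ hΓ
  refine ⟨A, c, hA, hc, fun z w hz hw => ?_⟩
  obtain ⟨γ, hγ, g, hg, p, hp, hpc⟩ := h (⟨z, hz⟩, ⟨w, hw⟩)
  have h1 := congrArg (fun q : ℍ × ℍ => (q.1 : ℂ)) hp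
  have h2 := congrArg (fun q : ℍ × ℍ => (q.2 : ℂ)) hp
  simp only [act, coe_map_smul] at h1 h2
  exact ⟨γ, hγ, g, hg, p.1, p.2, p.1.im_pos, p.2.im_pos, hpc, h1, h2⟩

theorem IsCurveForm.eq_zero [NumberField F] (hG : IsCurveForm σ₁ σ₂ Γ k₁ k₂ G)
    (hF : Module.finrank ℚ F = 2) (hσ : σ₁ ≠ σ₂) (hΓ : Γ.relIndex (fullGroup F) ≠ 0)
    (hk₁ : k₁ ≤ 0) (hk : k₁ < k₂ ∨ (k₁ = k₂ ∧ k₁ < 0)) {z w : ℂ} (hz : 0 < z.im) (hw : 0 < w.im) :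
    G z w = 0 := by
  by_contra hne
  have hpos : 0 < petersson k₁ k₂ G z w := by
    unfold petersson
    have h1 := norm_pos_iff.2 hne
    have h2 := zpow_pos (Real.sqrt_pos.2 hz) k₁
    have h3 := zpow_pos (Real.sqrt_pos.2 hw) k₂
    positivity
  obtain ⟨A, c, hA, hc, hred⟩ := exists_reduction_moebius hF hσ hΓ
  choose N a b δ hcusp using hG.cuspInvariant hF hσ hΓ
  -- The threshold is the norm at a point where `G` is assumed nonzero. Values outside the compact
  -- sets cannot exceed it, so the maximum over `S`, which contains that point, is global.
  choose K hK hKU hKA using fun g => (hcusp g).exists_compact hk hpos hc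
  set S : Set (ℂ × ℂ) := insert (z, w)
    (⋃ g ∈ A, (fun p : ℂ × ℂ => (moebius σ₁ g p.1, moebius σ₂ g p.2)) '' K g) with hS
  have hSc : IsCompact S := (hA.isCompact_biUnion fun g _ =>
    (hK g).image_of_continuousOn ((continuousOn_moebius_prod σ₁ σ₂ g).mono (hKU g))).insert _
  have hSU : S ⊆ {p | 0 < p.1.im ∧ 0 < p.2.im} := by
    intro p hp
    rcases hp with rfl | hp
    · exact ⟨hz, hw⟩
    · simp only [mem_iUnion] at hp
      obtain ⟨g, _, q, hq, rfl⟩ := hp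
      exact ⟨moebius_im_pos _ _ (hKU g hq).1, moebius_im_pos _ _ (hKU g hq).2⟩
  obtain ⟨⟨p, q⟩, hpS, hmax⟩ := hSc.exists_isMaxOn ⟨_, mem_insert _ _⟩
    ((hG.holo.continuousOn_petersson (k₁ := k₁) (k₂ := k₂)).mono hSU)
  have hle : petersson k₁ k₂ G z w ≤ petersson k₁ k₂ G p q := hmax (mem_insert _ _)
  have hglob : ∀ z' w' : ℂ, 0 < z'.im → 0 < w'.im →
      petersson k₁ k₂ G z' w' ≤ petersson k₁ k₂ G p q := by
    intro z' w' hz' hw'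
    obtain ⟨γ, hγ, g, hg, x, y, hx, hy, hxy, rfl, rfl⟩ := hred z' w' hz' hw'
    rw [hG.petersson_moebius hγ (moebius_im_pos _ _ hx) (moebius_im_pos _ _ hy),
      ← petersson_slash]
    rcases hKA g x y hx hy hxy with h | ⟨t, ht, h⟩
    · exact h.trans hle
    · rw [← h, petersson_slash]
      have hmem : (moebius σ₁ g t.1, moebius σ₂ g t.2) ∈ S := by
        refine Or.inr ?_
        simp only [mem_iUnion]
        exact ⟨g, hg, t, ht, rfl⟩
      exact hmax hmem
  obtain ⟨hp, hq⟩ : 0 < p.im ∧ 0 < q.im := hSU hpS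
  have hzero : G p q = 0 := by
    refine hG.holo.eq_zero_of_isMax hk₁ hp hq (fun z' hz' => hglob z' q hz' hq) fun ε hε => ?_
    -- On the slice `w = q` the product of heights grows with `Im z`, so decay at the cusp `∞`
    -- itself, `g = 1`, suffices.
    obtain ⟨T, hT⟩ := (hcusp 1).petersson_tendsto_zero hk hε
    refine ⟨T / q.im, fun z' hz' hTz => ?_⟩
    have := hT z' q hz' hq (by rwa [div_le_iff₀ hq] at hTz)
    rw [petersson_slash] at this
    simpa [moebius, num, den] using this
  have : petersson k₁ k₂ G p q = 0 := by simp [petersson, hzero]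
  linarith

/-- The chain rule contributes `(c z + d)^(-2)`. Weight zero matters in the first variable, where
the automorphy factor would otherwise be differentiated too. -/
lemma IsCurveForm.deriv₁ (hG : IsCurveForm σ₁ σ₂ Γ 0 0 G) :
    IsCurveForm σ₁ σ₂ Γ 2 0 (deriv₁ G) where
  holo := hG.holo.deriv₁
  transform γ hγ z w hz hw := by
    have hopen : IsOpen {t : ℂ | 0 < t.im} := isOpen_lt continuous_const continuous_im
    have hw' := moebius_im_pos σ₂ γ hw
    have hz' := moebius_im_pos σ₁ γ hz
    have h1 : HasDerivAt (fun t => G t (moebius σ₂ γ w))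
        (HilbertModular.deriv₁ G (moebius σ₁ γ z) (moebius σ₂ γ w)) (moebius σ₁ γ z) :=
      ((hG.holo.differentiableOn_left hw').differentiableAt (hopen.mem_nhds hz')).hasDerivAt
    have h2 : HasDerivAt (fun t => G t w) (HilbertModular.deriv₁ G z w) z :=
      ((hG.holo.differentiableOn_left hw).differentiableAt (hopen.mem_nhds hz)).hasDerivAt
    have h3 := h1.comp z (hasDerivAt_moebius σ₁ γ hz)
    have h4 : HasDerivAt (fun t => G t w) (HilbertModular.deriv₁ G (moebius σ₁ γ z)
        (moebius σ₂ γ w) * den σ₁ γ z ^ (-2 : ℤ)) z := by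
      refine h3.congr_of_eventuallyEq ?_
      filter_upwards [hopen.mem_nhds hz] with t ht
      simpa using (hG.transform γ hγ t w ht hw).symm
    have h5 := h2.unique h4
    have hd := den_ne_zero σ₁ γ hz
    rw [h5, zpow_zero, mul_one, mul_comm, mul_assoc, ← zpow_add₀ hd]
    simp

lemma IsCurveForm.eq_left [NumberField F] (hG : IsCurveForm σ₁ σ₂ Γ 0 0 G)
    (hF : Module.finrank ℚ F = 2) (hσ : σ₁ ≠ σ₂) (hΓ : Γ.relIndex (fullGroup F) ≠ 0)
    {z z' w : ℂ} (hz : 0 < z.im) (hz' : 0 < z'.im) (hw : 0 < w.im) : G z w = G z' w := by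
  have hopen : IsOpen {t : ℂ | 0 < t.im} := isOpen_lt continuous_const continuous_im
  refine hopen.is_const_of_deriv_eq_zero (convex_halfSpace_im_gt 0).isPreconnected
    (hG.holo.differentiableOn_left hw) (fun t ht => ?_) hz hz'
  -- After exchanging variables the derivative has weight `(0, 2)`, where vanishing is already
  -- known.
  exact hG.deriv₁.swap.eq_zero hF hσ.symm hΓ le_rfl (Or.inl two_pos) hw ht

lemma IsHolomorphicForm.isCurveForm {f : ℍ × ℍ → ℂ} (hf : IsHolomorphicForm σ₁ σ₂ Γ k₁ k₂ f) :
    IsCurveForm σ₁ σ₂ Γ k₁ k₂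
      fun z w => f (UpperHalfPlane.ofComplex z, UpperHalfPlane.ofComplex w) where
  holo :=
    { continuousOn := hf.holomorphic.continuousOn
      differentiableOn := fun V α β _ hα hβ h =>
        DifferentiableOn.comp (g := fun w : ℂ × ℂ =>
          f (UpperHalfPlane.ofComplex w.1, UpperHalfPlane.ofComplex w.2)) hf.holomorphic
          (hα.prodMk hβ) h }
  transform γ hγ z w hz hw := by
    have h := hf.transform γ hγ (⟨z, hz⟩, ⟨w, hw⟩)
    rw [UpperHalfPlane.ofComplex_apply_of_im_pos hz, UpperHalfPlane.ofComplex_apply_of_im_pos hw]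
    refine Eq.trans ?_ h
    congr 1
    rw [act, ← UpperHalfPlane.ofComplex_apply (_ • _), coe_map_smul,
      ← UpperHalfPlane.ofComplex_apply (Matrix.SpecialLinearGroup.map σ₂ γ • _), coe_map_smul]
    rfl

end HilbertModular

/-- `F` is a real quadratic field: it has degree two over `ℚ`, and `σ₁ ≠ σ₂` are its two real
embeddings. -/
theorem mainTheorem5 (F : Type*) [Field F] [NumberField F] (hF : Module.finrank ℚ F = 2)
    (σ₁ σ₂ : F →+* ℝ) (hσ : σ₁ ≠ σ₂)
    (Γ : Subgroup SL(2, F)) (hΓ : Γ.Commensurable (HilbertModular.fullGroup F))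
    (k₁ k₂ : ℤ) (f : ℍ × ℍ → ℂ)
    (hf : HilbertModular.IsHolomorphicForm σ₁ σ₂ Γ k₁ k₂ f) :
    (¬ ((0 < k₁ ∧ 0 < k₂) ∨ (k₁ = 0 ∧ k₂ = 0)) → ∀ z, f z = 0) ∧
      (k₁ = 0 ∧ k₂ = 0 → ∃ c : ℂ, ∀ z, f z = c) := by
  have hG := hf.isCurveForm
  have hval : ∀ z : ℍ × ℍ,
      f (UpperHalfPlane.ofComplex (z.1 : ℂ), UpperHalfPlane.ofComplex (z.2 : ℂ)) = f z := by
    intro z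
    rw [UpperHalfPlane.ofComplex_apply, UpperHalfPlane.ofComplex_apply]
  refine ⟨fun hk z => ?_, ?_⟩
  · rw [← hval z]
    rcases le_total k₁ k₂ with h | h
    · exact hG.eq_zero hF hσ hΓ.1 (by omega) (by omega) z.1.im_pos z.2.im_pos
    · exact hG.swap.eq_zero hF hσ.symm hΓ.1 (by omega) (by omega) z.2.im_pos z.1.im_pos
  · rintro ⟨rfl, rfl⟩
    refine ⟨f (UpperHalfPlane.I, UpperHalfPlane.I), fun z => ?_⟩
    rw [← hval z, ← hval (UpperHalfPlane.I, UpperHalfPlane.I)]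
    exact (hG.eq_left hF hσ hΓ.1 z.1.im_pos UpperHalfPlane.I.im_pos z.2.im_pos).trans
      (hG.swap.eq_left hF hσ.symm hΓ.1 z.2.im_pos UpperHalfPlane.I.im_pos UpperHalfPlane.I.im_pos)
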